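/- Let $\mathcal L$ be a (single-sorted) continuous signature. $\mathcal L$-formulas are built from atomic formulas (including those with the distance symbol $d$) with the connectives $\neg t=1-t$, $\tfrac12 t=t/2$, $s\dot- t=\max(s-t,0)$ and the quantifiers $\inf_y,\sup_y$; $\mathcal L$-structures are non-empty complete metric spaces of diameter at most $1$ with interpretations of the symbols that respect the uniform continuity moduli of $\mathcal L$. Let $\Omega$ be a set, let $\mathscr M=(\mathcal M_\omega)_{\omega\in\Omega}$ be a family of $\mathcal L$-structures, let $\mathbf M=\prod_{\omega\in\Omega} M_\omega$ be the set of all sections, let $\mathscr A=[0,1]^\Omega$, and let $E\colon\mathscr A\to[0,1]$ be a finitely additive probability integration functional, i.e. $E(1)=1$ and $E(X+Y)=E(X)+E(Y)$ whenever $X,Y,X+Y\in\mathscr A$. For a formula $\varphi(\bar x)$ and $\bar{\mathbf a}\in\mathbf M^n$ let $\langle\varphi(\bar{\mathbf a})\rangle\in\mathscr A$ be the function $\omega\mapsto\varphi^{\mathcal M_\omega}(\bar{\mathbf a}(\omega))$. Equip $\mathbf M$ with the pseudo-metric $E\langle d(\mathbf a,\mathbf b)\rangle$ and $\mathscr A$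 with the pseudo-metric $E(|X-Y|)$. Let $\widehat{\mathbf M},\widehat{\mathscr A}$ be the associated (Hausdorff) completions, with canonical maps $[\cdot]$. The function symbols of $\mathcal L$ on $\mathbf M$, the operations $0,\neg,\tfrac12,\dot-$ on $\mathscr A$, and, for every predicate symbol $P$ (and for $d$), the map $\llbracket P\rrbracket\colon\bar{\mathbf a}\mapsto\langle P(\bar{\mathbf a})\rangle$ extend continuously to the completions; the result $(\widehat{\mathbf M},\widehat{\mathscr A})$ is the structure associated to the randomisation $(\mathbf M,\mathscr A)$. Ordered by $X\le Y\iff X\dot-Y=0$, $\widehat{\mathscr A}$ is a complete lattice. For a formula $\varphi(\bar x)$ define $\llbracket\varphi(\bar{\mathbf x})\rrbracket\colon\widehat{\mathbf M}^n\to\widehat{\mathscr A}$ by induction: for atomic formulas compose $\llbracket P\rrbracket$ with terms, connectives are applied in $\widehat{\mathscr A}$, and $\llbracket\inf_y\varphi(\bar{\mathbf x},y)\rrbracket=\inf_{\mathbf b\in\widehat{\mathbf M}}\llbracket\varphi(\bar{\mathbf x},\mathbf b)\rrbracket$ and $\llbracket\sup_y\varphi(\bar{\mathbf x},y)\rrbracket=\sup_{\mathbf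 b\in\widehat{\mathbf M}}\llbracket\varphi(\bar{\mathbf x},\mathbf b)\rrbracket$ in the lattice $\widehat{\mathscr A}$. Then: 1. $(\mathbf M,\mathscr A)$ is full: for all $\mathbf a,\mathbf b\in\mathbf M$ and $X\in\mathscr A$ there is $\mathbf c\in\mathbf M$ such that, for every $\omega$, $\mathbf c(\omega)=\mathbf a(\omega)$ if $X(\omega)=1$ and $\mathbf c(\omega)=\mathbf b(\omega)$ if $X(\omega)=0$. 2. For every formula $\varphi(\bar x)$ and every $\bar{\mathbf a}\in\mathbf M^n$, $$\bigl[\langle\varphi(\bar{\mathbf a})\rangle\bigr]=\llbracket\varphi([\bar{\mathbf a}])\rrbracket .$$ -/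

import Mathlib

universe u v w x y

namespace ContLogic

open Filter Topology UniformSpace

/-! ### Truth values: the connectives on the unit interval -/

/-- Truncated subtraction `x ∸ y = max (x - y) 0` on `[0,1]`. -/
noncomputable def usub (s t : unitInterval) : unitInterval :=
  ⟨max ((s : ℝ) - t) 0, le_max_right _ _,
    max_le (by linarith [s.2.2, t.2.1]) zero_le_one⟩

/-- Negation `1 - x` on `[0,1]`. -/
noncomputable def uneg (s : unitInterval) : unitInterval :=
  ⟨1 - (s : ℝ), by linarith [s.2.2], by linarith [s.2.1]⟩

/-- Halving `x / 2` on `[0,1]`. -/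
noncomputable def uhalf (s : unitInterval) : unitInterval :=
  ⟨(s : ℝ) / 2, by linarith [s.2.1], by linarith [s.2.2]⟩

/-! ### Continuous signatures, terms, formulas, structures -/

/-- A map on `n`-tuples respects the uniform continuity moduli `δ i` (one for each argument). -/
def RespectsModuli {X : Type u} {Y : Type v} [PseudoMetricSpace X] [PseudoMetricSpace Y] {n : ℕ}
    (δ : Fin n → ℝ → ℝ) (g : (Fin n → X) → Y) : Prop :=
  ∀ (i : Fin n) (ε : ℝ), 0 < ε → ∀ (a : Fin n → X) (x y : X), dist x y < δ i ε →
    dist (g (Function.update a i x)) (g (Function.update a i y)) ≤ ε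

/-- A (single-sorted) continuous signature: function and predicate symbols with arities and
uniform continuity moduli. The distance symbol is present in every signature and is not listed
among the predicate symbols. -/
structure Signature where
  Func : Type u
  Pred : Type v
  arityF : Func → ℕ
  arityP : Pred → ℕ
  modF : (f : Func) → Fin (arityF f) → ℝ → ℝ
  modP : (P : Pred) → Fin (arityP P) → ℝ → ℝ
  modF_pos : ∀ f i ε, 0 < ε → 0 < modF f i ε
  modP_pos : ∀ P i ε, 0 < ε → 0 < modP P i ε

/-- Terms with variables from `α`. -/
inductive Term (L : Signature.{u, v}) (α : Type w) : Type (max u w)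
  | var : α → Term L α
  | app : (f : L.Func) → (Fin (L.arityF f) → Term L α) → Term L α

/-- Evaluation of a term, for an interpretation `F` of the function symbols. -/
def Term.eval {L : Signature.{u, v}} {α : Type w} {X : Type x}
    (F : (f : L.Func) → (Fin (L.arityF f) → X) → X) (a : α → X) : Term L α → X
  | .var i => a i
  | .app f ts => F f fun j => (ts j).eval F a

/-- Formulas of continuous logic with free variables `x_0, …, x_{n-1}`. A quantifier binds the
last variable. -/
inductive Formula (L : Signature.{u, v}) : ℕ → Type (max u v)
  | pred {n : ℕ} (P : L.Pred) (ts : Fin (L.arityP P) → Term L (Fin n)) : Formula L n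
  | dist {n : ℕ} (s t : Term L (Fin n)) : Formula L n
  | neg {n : ℕ} (φ : Formula L n) : Formula L n
  | half {n : ℕ} (φ : Formula L n) : Formula L n
  | sub {n : ℕ} (φ ψ : Formula L n) : Formula L n
  | inf {n : ℕ} (φ : Formula L (n + 1)) : Formula L n
  | sup {n : ℕ} (φ : Formula L (n + 1)) : Formula L n

/-- A structure for the signature `L`: a non-empty complete metric space of diameter at most `1`
with interpretations of the symbols that respect the moduli of `L`. -/
structure Struc (L : Signature.{u, v}) where
  carrier : Type w
  [metric : MetricSpace carrier]
  [complete : CompleteSpace carrier]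
  [nonempty : Nonempty carrier]
  dist_le_one : ∀ a b : carrier, dist a b ≤ 1
  func : (f : L.Func) → (Fin (L.arityF f) → carrier) → carrier
  pred : (P : L.Pred) → (Fin (L.arityP P) → carrier) → unitInterval
  func_mod : ∀ f, RespectsModuli (L.modF f) (func f)
  pred_mod : ∀ P, RespectsModuli (L.modP P) (pred P)

attribute [instance] Struc.metric Struc.complete Struc.nonempty

/-- The distance of a structure, as a truth value. -/
noncomputable def Struc.udist {L : Signature.{u, v}} (𝓜 : Struc.{u, v, w} L)
    (a b : 𝓜.carrier) : unitInterval :=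
  ⟨dist a b, dist_nonneg, 𝓜.dist_le_one a b⟩

/-- The value `φ^𝓜(a)` of a formula in a structure. -/
noncomputable def Struc.value {L : Signature.{u, v}} (𝓜 : Struc.{u, v, w} L) :
    {n : ℕ} → Formula L n → (Fin n → 𝓜.carrier) → unitInterval
  | _, .pred P ts, a => 𝓜.pred P fun j => (ts j).eval 𝓜.func a
  | _, .dist s t, a => 𝓜.udist (s.eval 𝓜.func a) (t.eval 𝓜.func a)
  | _, .neg φ, a => uneg (𝓜.value φ a)
  | _, .half φ, a => uhalf (𝓜.value φ a)
  | _, .sub φ ψ, a => usub (𝓜.value φ a) (𝓜.value ψ a)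
  | _, .inf φ, a => ⨅ b : 𝓜.carrier, 𝓜.value φ (Fin.snoc a b)
  | _, .sup φ, a => ⨆ b : 𝓜.carrier, 𝓜.value φ (Fin.snoc a b)

/-! ### Models of the theory `RV` -/

/-- A model of the theory `RV` of `[0,1]`-valued random variables: a complete metric space of
diameter at most `1` with operations `0, ¬, ½, ∸` that are `1`-Lipschitz in each argument and
satisfy the axioms of `RV`. Here `E(x)` is `dist x 0`, `1` is `¬0` and `y ∧ x` is
`y ∸ (y ∸ x)`. -/
structure RVModel where
  carrier : Type u
  [metric : MetricSpace carrier]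
  [complete : CompleteSpace carrier]
  dist_le_one : ∀ a b : carrier, dist a b ≤ 1
  zero : carrier
  neg : carrier → carrier
  half : carrier → carrier
  sub : carrier → carrier → carrier
  dist_neg_le : ∀ a b, dist (neg a) (neg b) ≤ dist a b
  dist_half_le : ∀ a b, dist (half a) (half b) ≤ dist a b
  dist_sub_left_le : ∀ a b c, dist (sub a c) (sub b c) ≤ dist a b
  dist_sub_right_le : ∀ a b c, dist (sub c a) (sub c b) ≤ dist a b
  rv1 : ∀ a b, dist a zero = dist (sub a b) zero + dist (sub b (sub b a)) zero
  rv2 : dist (neg zero) zero = 1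
  rv3 : ∀ a b, dist a b = dist (sub a b) zero + dist (sub b a) zero
  rv4_1 : ∀ a b, sub (sub a b) a = zero
  rv4_2 : ∀ a b c, sub (sub (sub a c) (sub a b)) (sub b c) = zero
  rv4_3 : ∀ a b, sub (sub a (sub a b)) (sub b (sub b a)) = zero
  rv4_4 : ∀ a b, sub (sub a b) (sub (neg b) (neg a)) = zero
  rv4_5 : ∀ a, sub (half a) (sub a (half a)) = zero
  rv4_6 : ∀ a, sub (sub a (half a)) (half a) = zero

attribute [instance] RVModel.metric RVModel.complete

namespace RVModel

variable (A : RVModel.{u})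

theorem e_sub_le (a b : A.carrier) : dist (A.sub a b) A.zero ≤ dist a A.zero := by
  have := A.rv1 a b
  have h : 0 ≤ dist (A.sub b (A.sub b a)) A.zero := dist_nonneg
  linarith

theorem mp {a b : A.carrier} (hb : b = A.zero) (h : A.sub a b = A.zero) : a = A.zero := by
  have h1 := A.rv1 a b
  have h2 := A.e_sub_le b (A.sub b a)
  rw [h, dist_self] at h1
  rw [hb, dist_self] at h2
  have : dist a A.zero ≤ 0 := by rw [hb] at h1; linarith
  exact dist_le_zero.1 this

theorem le_antisymm' {a b : A.carrier} (h : A.sub a b = A.zero) (h' : A.sub b a = A.zero) :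
    a = b := by
  have := A.rv3 a b
  rw [h, h', dist_self] at this
  exact dist_le_zero.1 (by linarith)

theorem zero_sub (a : A.carrier) : A.sub A.zero a = A.zero := by
  have := A.e_sub_le A.zero a
  rw [dist_self] at this
  exact dist_le_zero.1 this

theorem meet_comm (a b : A.carrier) : A.sub a (A.sub a b) = A.sub b (A.sub b a) :=
  A.le_antisymm' (A.rv4_3 a b) (A.rv4_3 b a)

theorem sub_zero (a : A.carrier) : A.sub a A.zero = a := by
  refine A.le_antisymm' (A.rv4_1 _ _) ?_
  rw [A.meet_comm, A.zero_sub]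

theorem sub_self (a : A.carrier) : A.sub a a = A.zero := by
  have := A.rv4_1 a A.zero
  rwa [A.sub_zero] at this

/-- The order of a model of `RV`: `a ≤ b` if and only if `a ∸ b = 0`. -/
instance : PartialOrder A.carrier where
  le a b := A.sub a b = A.zero
  le_refl a := A.sub_self a
  le_trans a b c h h' := A.mp h (A.mp h' (A.rv4_2 a b c))
  le_antisymm _ _ h h' := A.le_antisymm' h h'

variable {A}

theorem le_def {a b : A.carrier} : a ≤ b ↔ A.sub a b = A.zero := Iff.rfl

theorem sub_anti {a b c : A.carrier} (h : b ≤ c) : A.sub a c ≤ A.sub a b :=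
  A.mp (le_def.1 h) (A.rv4_2 a b c)

theorem le_meet {a b c : A.carrier} (hb : c ≤ a) (hc : c ≤ b) : c ≤ A.sub a (A.sub a b) := by
  have h1 : A.sub a (A.sub a c) = c := by
    rw [A.meet_comm, le_def.1 hb, A.sub_zero]
  calc c = A.sub a (A.sub a c) := h1.symm
    _ ≤ A.sub a (A.sub a b) := sub_anti (sub_anti hc)

theorem le_neg_neg (a : A.carrier) : a ≤ A.neg (A.neg a) := by
  have h1 : A.sub a A.zero ≤ A.sub (A.neg A.zero) (A.neg a) := A.rv4_4 _ _
  rw [A.sub_zero] at h1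
  have h2 : A.sub (A.neg A.zero) (A.neg a) ≤
    A.sub (A.neg (A.neg a)) (A.neg (A.neg A.zero)) := A.rv4_4 _ _
  exact h1.trans (h2.trans (A.rv4_1 _ _))

theorem neg_neg (a : A.carrier) : A.neg (A.neg a) = a := by
  refine le_antisymm ?_ (le_neg_neg a)
  exact A.mp (le_def.1 (le_neg_neg (A.neg a))) (A.rv4_4 _ _)

theorem le_one (a : A.carrier) : a ≤ A.neg A.zero := by
  have h : A.sub a (A.neg A.zero) ≤ A.sub (A.neg (A.neg A.zero)) (A.neg a) := A.rv4_4 _ _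
  rw [neg_neg, A.zero_sub] at h
  exact A.mp rfl h

/-- Every subset of a model of `RV` has a greatest lower bound. -/
theorem exists_isGLB (S : Set A.carrier) : ∃ m, IsGLB S m := by
  let C : Set A.carrier := upperBounds (lowerBounds S)
  have hSC : S ⊆ C := fun s hs w hw => hw hs
  have hmeet : ∀ a ∈ C, ∀ b ∈ C, A.sub a (A.sub a b) ∈ C :=
    fun a ha b hb w hw => le_meet (ha hw) (hb hw)
  let e : A.carrier → ℝ := fun a => dist a A.zero
  have hne : (e '' C).Nonempty := ⟨_, A.neg A.zero, fun w _ => le_one w, rfl⟩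
  have hbdd : BddBelow (e '' C) := ⟨0, by rintro _ ⟨a, _, rfl⟩; exact dist_nonneg⟩
  let r := sInf (e '' C)
  have hr : ∀ a ∈ C, r ≤ e a := fun a ha => csInf_le hbdd ⟨a, ha, rfl⟩
  have hex : ∀ n : ℕ, ∃ a ∈ C, e a < r + 1 / ((n : ℝ) + 1) := by
    intro n
    obtain ⟨_, ⟨a, ha, rfl⟩, h⟩ :=
      exists_lt_of_csInf_lt hne (show sInf (e '' C) < r + 1 / ((n : ℝ) + 1) by
        have : (0 : ℝ) < 1 / ((n : ℝ) + 1) := by positivity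
        change r < _
        linarith)
    exact ⟨a, ha, h⟩
  choose X hXC hX using hex
  have hsub : ∀ a b, e (A.sub a b) = e a - e (A.sub b (A.sub b a)) := fun a b => by
    have := A.rv1 a b
    simp only [e]; linarith
  have hcau : CauchySeq X := by
    refine cauchySeq_of_le_tendsto_0 (fun n : ℕ => 2 * (1 / ((n : ℝ) + 1))) ?_ ?_
    · intro n m N hn hm
      have h1 := A.rv3 (X n) (X m)
      have h2 := hsub (X n) (X m)
      have h3 := hsub (X m) (X n)
      have h4 := hr _ (hmeet _ (hXC m) _ (hXC n))
      have h5 := hr _ (hmeet _ (hXC n) _ (hXC m))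
      have h6 := hX n
      have h7 := hX m
      have h8 : 1 / ((n : ℝ) + 1) ≤ 1 / ((N : ℝ) + 1) :=
        one_div_le_one_div_of_le (by positivity) (by exact_mod_cast Nat.succ_le_succ hn)
      have h9 : 1 / ((m : ℝ) + 1) ≤ 1 / ((N : ℝ) + 1) :=
        one_div_le_one_div_of_le (by positivity) (by exact_mod_cast Nat.succ_le_succ hm)
      change dist _ _ = e _ + e _ at h1
      linarith
    · simpa using (tendsto_one_div_add_atTop_nhds_zero_nat (𝕜 := ℝ)).const_mul 2
  obtain ⟨m, hm⟩ := cauchySeq_tendsto_of_complete hcau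
  have hcl : ∀ c, Continuous fun a => A.sub a c := fun c =>
    (LipschitzWith.mk_one fun a b => A.dist_sub_left_le a b c).continuous
  have hcr : ∀ c, Continuous fun a => A.sub c a := fun c =>
    (LipschitzWith.mk_one fun a b => A.dist_sub_right_le a b c).continuous
  refine ⟨m, ?_, ?_⟩
  · intro s hs
    have h1 : Tendsto (fun n => e (A.sub (X n) s)) atTop (𝓝 (e (A.sub m s))) :=
      (((hcl s).dist continuous_const).tendsto m).comp hm
    have h2 : Tendsto (fun n => e (A.sub (X n) s)) atTop (𝓝 0) := by
      refine squeeze_zero (fun n => dist_nonneg) (fun n => ?_)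
        (tendsto_one_div_add_atTop_nhds_zero_nat (𝕜 := ℝ))
      have h3 := hsub (X n) s
      have h4 := hr _ (hmeet _ (hSC hs) _ (hXC n))
      have h5 := hX n
      linarith
    exact dist_eq_zero.1 (tendsto_nhds_unique h1 h2)
  · intro w hw
    have h1 : Tendsto (fun n => A.sub w (X n)) atTop (𝓝 (A.sub w m)) :=
      ((hcr w).tendsto m).comp hm
    have h2 : (fun n => A.sub w (X n)) = fun _ => A.zero := funext fun n => hXC n hw
    rw [h2] at h1
    exact tendsto_nhds_unique h1 tendsto_const_nhds

noncomputable instance : InfSet A.carrier := ⟨fun S => (exists_isGLB S).choose⟩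

/-- A model of `RV` is a complete lattice for the order `a ≤ b ↔ a ∸ b = 0`. -/
noncomputable instance : CompleteLattice A.carrier :=
  completeLatticeOfInf _ fun S => (exists_isGLB S).choose_spec

end RVModel

/-! ### Structures for the randomisation signature -/

/-- A uniform continuity modulus for the randomisation of a symbol with modulus `δ`. -/
noncomputable def randMod (δ : ℝ → ℝ) (ε : ℝ) : ℝ := ε * min (δ (ε / 4)) 1 / 4

/-- A structure for the randomisation signature of `L` whose auxiliary sort is a model of `RV`:
a main sort on which the function symbols of `L` are interpreted, an auxiliary sort, and for every
predicate symbol `P` of `L` (and for the distance symbol) a function `⟦P⟧` from the main sort to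
the auxiliary sort. -/
structure RandStruc (L : Signature.{u, v}) where
  main : Type w
  [metric : MetricSpace main]
  [complete : CompleteSpace main]
  [nonempty : Nonempty main]
  main_dist_le_one : ∀ a b : main, dist a b ≤ 1
  aux : RVModel.{x}
  func : (f : L.Func) → (Fin (L.arityF f) → main) → main
  pred : (P : L.Pred) → (Fin (L.arityP P) → main) → aux.carrier
  rdist : main → main → aux.carrier
  func_mod : ∀ f, RespectsModuli (fun i => randMod (L.modF f i)) (func f)
  pred_mod : ∀ P, RespectsModuli (fun i => randMod (L.modP P i)) (pred P)
  dist_rdist_left_le : ∀ a b c, dist (rdist a c) (rdist b c) ≤ dist a b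
  dist_rdist_right_le : ∀ a b c, dist (rdist c a) (rdist c b) ≤ dist a b

attribute [instance] RandStruc.metric RandStruc.complete RandStruc.nonempty

/-- The value `⟦φ(a)⟧`, an element of the auxiliary sort. Quantifiers are interpreted by infima and
suprema in the complete lattice which is the auxiliary sort. -/
noncomputable def RandStruc.value {L : Signature.{u, v}} (𝓡 : RandStruc.{u, v, w, x} L) :
    {n : ℕ} → Formula L n → (Fin n → 𝓡.main) → 𝓡.aux.carrier
  | _, .pred P ts, a => 𝓡.pred P fun j => (ts j).eval 𝓡.func a
  | _, .dist s t, a => 𝓡.rdist (s.eval 𝓡.func a) (t.eval 𝓡.func a)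
  | _, .neg φ, a => 𝓡.aux.neg (𝓡.value φ a)
  | _, .half φ, a => 𝓡.aux.half (𝓡.value φ a)
  | _, .sub φ ψ, a => 𝓡.aux.sub (𝓡.value φ a) (𝓡.value ψ a)
  | _, .inf φ, a => ⨅ b : 𝓡.main, 𝓡.value φ (Fin.snoc a b)
  | _, .sup φ, a => ⨆ b : 𝓡.main, 𝓡.value φ (Fin.snoc a b)

/-! ### Integration spaces and randomisations -/

/-- `(Ω, A, E)` is a finitely additive probability integration space. -/
structure IsIntegrationSpace {Ω : Type w} (A : Set (Ω → unitInterval)) (E : A → unitInterval) :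
    Prop where
  nonempty : A.Nonempty
  neg_mem : ∀ X ∈ A, (fun ω => uneg (X ω)) ∈ A
  half_mem : ∀ X ∈ A, (fun ω => uhalf (X ω)) ∈ A
  sub_mem : ∀ X ∈ A, ∀ Y ∈ A, (fun ω => usub (X ω) (Y ω)) ∈ A
  E_one : ∀ U : A, (∀ ω, U.1 ω = 1) → E U = 1
  E_add : ∀ X Y Z : A, (∀ ω, (Z.1 ω : ℝ) = X.1 ω + Y.1 ω) → (E Z : ℝ) = E X + E Y

/-- The function `⟨φ(a)⟩ : Ω → [0,1]` for a tuple `a` of sections of a family of structures. -/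
noncomputable def bracket {L : Signature.{u, v}} {Ω : Type w} (ℳ : Ω → Struc.{u, v, x} L) {n : ℕ}
    (φ : Formula L n) (a : Fin n → (ω : Ω) → (ℳ ω).carrier) : Ω → unitInterval :=
  fun ω => (ℳ ω).value φ fun i => a i ω

/-- A randomisation `(M, A, E)` based on a family of structures. -/
structure Randomisation {L : Signature.{u, v}} {Ω : Type w} (ℳ : Ω → Struc.{u, v, x} L) where
  M : Set ((ω : Ω) → (ℳ ω).carrier)
  A : Set (Ω → unitInterval)
  E : A → unitInterval
  integration : IsIntegrationSpace A E
  nonempty : M.Nonempty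
  func_mem : ∀ (f : L.Func) (a : Fin (L.arityF f) → (ω : Ω) → (ℳ ω).carrier),
    (∀ i, a i ∈ M) → (fun ω => (ℳ ω).func f fun i => a i ω) ∈ M
  pred_mem : ∀ (P : L.Pred) (a : Fin (L.arityP P) → (ω : Ω) → (ℳ ω).carrier),
    (∀ i, a i ∈ M) → (fun ω => (ℳ ω).pred P fun i => a i ω) ∈ A
  dist_mem : ∀ a ∈ M, ∀ b ∈ M, (fun ω => (ℳ ω).udist (a ω) (b ω)) ∈ A

/-- A randomisation is full if sections can be glued along every `X ∈ A`. -/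
def Randomisation.IsFull {L : Signature.{u, v}} {Ω : Type w} {ℳ : Ω → Struc.{u, v, x} L}
    (R : Randomisation ℳ) : Prop :=
  ∀ a ∈ R.M, ∀ b ∈ R.M, ∀ X ∈ R.A, ∃ c ∈ R.M, ∀ ω,
    (X ω = 1 → c ω = a ω) ∧ (X ω = 0 → c ω = b ω)

/-- The randomisation `(∏ ℳ, [0,1]^Ω, E)`. -/
def productRandomisation {L : Signature.{u, v}} {Ω : Type w} (ℳ : Ω → Struc.{u, v, x} L)
    (E : ↥(Set.univ : Set (Ω → unitInterval)) → unitInterval)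
    (hE : IsIntegrationSpace Set.univ E) : Randomisation ℳ where
  M := Set.univ
  A := Set.univ
  E := E
  integration := hE
  nonempty := ⟨fun _ => Classical.choice inferInstance, trivial⟩
  func_mem _ _ _ := trivial
  pred_mem _ _ _ := trivial
  dist_mem _ _ _ _ := trivial

/-! ### The pre-structure of a randomisation -/

namespace IsIntegrationSpace

variable {Ω : Type w} {A : Set (Ω → unitInterval)} {E : A → unitInterval}

/-- Negation on `A`. -/
noncomputable def neg (h : IsIntegrationSpace A E) (X : A) : A := ⟨_, h.neg_mem _ X.2⟩

/-- Halving on `A`. -/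
noncomputable def half (h : IsIntegrationSpace A E) (X : A) : A := ⟨_, h.half_mem _ X.2⟩

/-- Truncated subtraction on `A`. -/
noncomputable def sub (h : IsIntegrationSpace A E) (X Y : A) : A := ⟨_, h.sub_mem _ X.2 _ Y.2⟩

theorem neg_val (h : IsIntegrationSpace A E) (X : A) (ω : Ω) :
    ((h.neg X).1 ω : ℝ) = 1 - X.1 ω := rfl

theorem half_val (h : IsIntegrationSpace A E) (X : A) (ω : Ω) :
    ((h.half X).1 ω : ℝ) = X.1 ω / 2 := rfl

theorem sub_val (h : IsIntegrationSpace A E) (X Y : A) (ω : Ω) :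
    ((h.sub X Y).1 ω : ℝ) = max ((X.1 ω : ℝ) - Y.1 ω) 0 := rfl

theorem zero_mem (h : IsIntegrationSpace A E) : (fun _ => 0 : Ω → unitInterval) ∈ A := by
  obtain ⟨X, hX⟩ := h.nonempty
  have := h.sub_mem X hX X hX
  convert this using 2
  apply Subtype.ext
  simp [usub]

/-- The constant function `0`. -/
def zero (h : IsIntegrationSpace A E) : A := ⟨fun _ => 0, h.zero_mem⟩

theorem zero_val (h : IsIntegrationSpace A E) (ω : Ω) : (h.zero.1 ω : ℝ) = 0 := rfl

theorem abs_mem (h : IsIntegrationSpace A E) (X Y : A) :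
    (fun ω => ⟨|(X.1 ω : ℝ) - Y.1 ω|, abs_nonneg _,
      abs_le.2 ⟨by linarith [(X.1 ω).2.1, (Y.1 ω).2.2], by linarith [(X.1 ω).2.2, (Y.1 ω).2.1]⟩⟩ :
      Ω → unitInterval) ∈ A := by
  have := (h.neg (h.sub (h.neg (h.sub X Y)) (h.sub Y X))).2
  convert this using 2 with ω
  apply Subtype.ext
  change |(X.1 ω : ℝ) - Y.1 ω| = 1 - max ((1 - max ((X.1 ω : ℝ) - Y.1 ω) 0) - max ((Y.1 ω : ℝ) - X.1 ω) 0) 0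
  have hx := (X.1 ω).2
  have hy := (Y.1 ω).2
  rcases le_total (X.1 ω : ℝ) (Y.1 ω) with hxy | hxy
  · rw [max_eq_right (by linarith : (X.1 ω : ℝ) - Y.1 ω ≤ 0),
      max_eq_left (by linarith : 0 ≤ (Y.1 ω : ℝ) - X.1 ω),
      max_eq_left (by linarith [hx.1, hy.2]), abs_of_nonpos (by linarith)]
    ring
  · rw [max_eq_left (by linarith : 0 ≤ (X.1 ω : ℝ) - Y.1 ω),
      max_eq_right (by linarith : (Y.1 ω : ℝ) - X.1 ω ≤ 0),
      max_eq_left (by linarith [hy.1, hx.2]), abs_of_nonneg (by linarith)]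
    ring

/-- The function `|X - Y|` as an element of `A`. -/
noncomputable def absDiff (h : IsIntegrationSpace A E) (X Y : A) : A := ⟨_, h.abs_mem X Y⟩

theorem absDiff_val (h : IsIntegrationSpace A E) (X Y : A) (ω : Ω) :
    ((h.absDiff X Y).1 ω : ℝ) = |(X.1 ω : ℝ) - Y.1 ω| := rfl

theorem E_zero (h : IsIntegrationSpace A E) {Z : A} (hZ : ∀ ω, (Z.1 ω : ℝ) = 0) :
    (E Z : ℝ) = 0 := by
  have := h.E_add Z Z Z (fun ω => by simp [hZ])
  linarith

theorem E_mono (h : IsIntegrationSpace A E) {X Y : A}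
    (hXY : ∀ ω, (X.1 ω : ℝ) ≤ Y.1 ω) : (E X : ℝ) ≤ E Y := by
  have := h.E_add X (h.sub Y X) Y (fun ω => by
    rw [sub_val, max_eq_left (by linarith [hXY ω])]; ring)
  linarith [(E (h.sub Y X)).2.1]

theorem E_meet (h : IsIntegrationSpace A E) (X Y : A) :
    (E X : ℝ) = E (h.sub X Y) + E (h.sub Y (h.sub Y X)) := by
  refine h.E_add _ _ _ fun ω => ?_
  simp only [sub_val]
  have hx := (X.1 ω).2
  have hy := (Y.1 ω).2
  rcases le_total (X.1 ω : ℝ) (Y.1 ω) with hxy | hxy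
  · rw [max_eq_right (by linarith : (X.1 ω : ℝ) - Y.1 ω ≤ 0),
      max_eq_left (by linarith : 0 ≤ (Y.1 ω : ℝ) - X.1 ω), max_eq_left (by linarith [hx.1])]
    ring
  · rw [max_eq_left (by linarith : 0 ≤ (X.1 ω : ℝ) - Y.1 ω),
      max_eq_right (by linarith : (Y.1 ω : ℝ) - X.1 ω ≤ 0), max_eq_left (by linarith [hy.1])]
    ring

theorem E_le_add (h : IsIntegrationSpace A E) {X Y Z : A}
    (hZ : ∀ ω, (Z.1 ω : ℝ) ≤ X.1 ω + Y.1 ω) : (E Z : ℝ) ≤ E X + E Y := by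
  have h1 := h.E_meet Z X
  have h2 : (E (h.sub Z X) : ℝ) ≤ E Y := h.E_mono fun ω => by
    rw [sub_val]; exact max_le (by linarith [hZ ω]) (Y.1 ω).2.1
  have h3 : (E (h.sub X (h.sub X Z)) : ℝ) ≤ E X := h.E_mono fun ω => by
    rw [sub_val]; exact max_le (by linarith [((h.sub X Z).1 ω).2.1]) (X.1 ω).2.1
  linarith

theorem E_half (h : IsIntegrationSpace A E) (X : A) : (E (h.half X) : ℝ) = E X / 2 := by
  have := h.E_add (h.half X) (h.half X) X (fun ω => by rw [half_val]; ring)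
  linarith

theorem exists_pow (h : IsIntegrationSpace A E) (n : ℕ) (X : A) :
    ∃ Y : A, (∀ ω, (Y.1 ω : ℝ) = (1 / 2) ^ n * X.1 ω) ∧ (E Y : ℝ) = (1 / 2) ^ n * E X := by
  induction n with
  | zero => exact ⟨X, by simp, by simp⟩
  | succ n ih =>
    obtain ⟨Y, hY, hE⟩ := ih
    exact ⟨h.half Y, fun ω => by rw [half_val, hY]; ring, by rw [E_half, hE]; ring⟩

/-- A pointwise uniform continuity estimate integrates. -/
theorem E_le_of_modulus (h : IsIntegrationSpace A E) {U V : A} {δ : ℝ → ℝ} {ε : ℝ} (hε : 0 < ε)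
    (hδ : 0 < δ (ε / 4)) (hUV : ∀ ω, (V.1 ω : ℝ) < δ (ε / 4) → (U.1 ω : ℝ) ≤ ε / 4)
    (hV : (E V : ℝ) < randMod δ ε) : (E U : ℝ) ≤ ε := by
  by_cases hε1 : 1 ≤ ε
  · exact (E U).2.2.trans hε1
  push Not at hε1
  have key : ∀ s : ℝ, 0 < s → s < 1 → ∃ n : ℕ, (1 / 2 : ℝ) ^ n ≤ s ∧ s / 2 ≤ (1 / 2) ^ n := by
    intro s hs hs1
    obtain ⟨n, hn1, hn2⟩ := exists_nat_pow_near_of_lt_one hs hs1.le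
      (by norm_num : (0 : ℝ) < 1 / 2) (by norm_num)
    refine ⟨n + 1, hn1.le, ?_⟩
    rw [pow_succ]; linarith
  set η := min (δ (ε / 4)) 1 with hη
  have hη0 : 0 < η := lt_min hδ one_pos
  have hη1 : η ≤ 1 := min_le_right _ _
  have hηδ : η ≤ δ (ε / 4) := min_le_left _ _
  obtain ⟨n, hn1, hn2⟩ := key (ε / 2) (by linarith) (by linarith)
  obtain ⟨m, hm1, hm2⟩ : ∃ m : ℕ, (1 / 2 : ℝ) ^ m ≤ η ∧ η / 2 ≤ (1 / 2) ^ m := by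
    rcases hη1.lt_or_eq with h1 | h1
    · exact key η hη0 h1
    · exact ⟨0, by simp [h1], by norm_num [h1]⟩
  have hone : ∃ O : A, ∀ ω, O.1 ω = 1 := ⟨h.neg h.zero, fun ω => by
    apply Subtype.ext; rw [neg_val, zero_val]; simp⟩
  obtain ⟨O, hO⟩ := hone
  obtain ⟨C, hC, hEC⟩ := h.exists_pow n O
  have hEO : (E O : ℝ) = 1 := by rw [h.E_one O hO]; rfl
  have hC' : ∀ ω, (C.1 ω : ℝ) = (1 / 2) ^ n := fun ω => by rw [hC, hO]; simp
  obtain ⟨W, hW, hEW⟩ := h.exists_pow m (h.sub U C)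
  have h1 : (E W : ℝ) ≤ E V := h.E_mono fun ω => by
    rw [hW, sub_val, hC']
    by_cases hv : (V.1 ω : ℝ) < δ (ε / 4)
    · rw [max_eq_right (by linarith [hUV ω hv])]
      simpa using (V.1 ω).2.1
    · push Not at hv
      have : max ((U.1 ω : ℝ) - (1 / 2) ^ n) 0 ≤ 1 := by
        refine max_le ?_ zero_le_one
        have : (0 : ℝ) < (1 / 2) ^ n := by positivity
        linarith [(U.1 ω).2.2]
      have h2 : (0 : ℝ) < (1 / 2) ^ m := by positivity
      nlinarith
  have h2 : (E U : ℝ) ≤ E (h.sub U C) + E C := h.E_le_add fun ω => by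
    rw [sub_val]; linarith [le_max_left ((U.1 ω : ℝ) - C.1 ω) 0]
  rw [hEC, hEO, mul_one] at h2
  have h3 : (E V : ℝ) < ε * η / 4 := hV
  have h4 : η / 2 * E (h.sub U C) ≤ (1 / 2 : ℝ) ^ m * E (h.sub U C) :=
    mul_le_mul_of_nonneg_right hm2 (E (h.sub U C)).2.1
  have h5 : η * (E (h.sub U C) : ℝ) < η * (ε / 2) := by
    rw [hEW] at h1; linarith
  have h6 := lt_of_mul_lt_mul_left h5 hη0.le
  linarith

end IsIntegrationSpace

namespace Randomisation

variable {L : Signature.{u, v}} {Ω : Type w} {ℳ : Ω → Struc.{u, v, x} L} (R : Randomisation ℳ)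

/-- The main sort of the pre-structure: the set `M` with the pseudo-metric
`d(a,b) = E⟨d(a,b)⟩`. -/
structure PreMain : Type (max w x) where
  val : R.M

/-- The auxiliary sort of the pre-structure: the set `A` with the pseudo-metric
`d(X,Y) = E(|X-Y|)`. -/
structure PreAux : Type w where
  val : R.A

/-- A section in the pre-structure, evaluated at a point. -/
def PreMain.at {R : Randomisation ℳ} (a : R.PreMain) (ω : Ω) : (ℳ ω).carrier := a.val.1 ω

/-- A random variable in the pre-structure, evaluated at a point. -/
def PreAux.at {R : Randomisation ℳ} (X : R.PreAux) (ω : Ω) : ℝ := (X.val.1 ω : ℝ)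

theorem PreAux.at_nonneg {R : Randomisation ℳ} (X : R.PreAux) (ω : Ω) : 0 ≤ X.at ω :=
  (X.val.1 ω).2.1

theorem PreAux.at_le_one {R : Randomisation ℳ} (X : R.PreAux) (ω : Ω) : X.at ω ≤ 1 :=
  (X.val.1 ω).2.2

/-- The function `⟨d(a,b)⟩`, as an element of `A`. -/
noncomputable def preRdist (a b : R.PreMain) : R.PreAux :=
  ⟨⟨fun ω => (ℳ ω).udist (a.at ω) (b.at ω), R.dist_mem _ a.val.2 _ b.val.2⟩⟩

/-- The action of a function symbol on `M`. -/
def preFunc (f : L.Func) (a : Fin (L.arityF f) → R.PreMain) : R.PreMain :=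
  ⟨⟨fun ω => (ℳ ω).func f fun i => (a i).at ω,
    R.func_mem f (fun i => (a i).val.1) fun i => (a i).val.2⟩⟩

/-- The function `⟨P(a)⟩`, as an element of `A`. -/
def prePred (P : L.Pred) (a : Fin (L.arityP P) → R.PreMain) : R.PreAux :=
  ⟨⟨fun ω => (ℳ ω).pred P fun i => (a i).at ω,
    R.pred_mem P (fun i => (a i).val.1) fun i => (a i).val.2⟩⟩

/-- The constant `0` of the auxiliary sort. -/
def preZero : R.PreAux := ⟨R.integration.zero⟩

/-- Negation on the auxiliary sort. -/
noncomputable def preNeg (X : R.PreAux) : R.PreAux := ⟨R.integration.neg X.val⟩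

/-- Halving on the auxiliary sort. -/
noncomputable def preHalf (X : R.PreAux) : R.PreAux := ⟨R.integration.half X.val⟩

/-- Truncated subtraction on the auxiliary sort. -/
noncomputable def preSub (X Y : R.PreAux) : R.PreAux := ⟨R.integration.sub X.val Y.val⟩

/-- The absolute difference `|X - Y|`. -/
noncomputable def preAbsDiff (X Y : R.PreAux) : R.PreAux := ⟨R.integration.absDiff X.val Y.val⟩

theorem preRdist_at (a b : R.PreMain) (ω : Ω) :
    (R.preRdist a b).at ω = dist (a.at ω) (b.at ω) := rfl

theorem preNeg_at (X : R.PreAux) (ω : Ω) : (R.preNeg X).at ω = 1 - X.at ω := rfl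

theorem preHalf_at (X : R.PreAux) (ω : Ω) : (R.preHalf X).at ω = X.at ω / 2 := rfl

theorem preSub_at (X Y : R.PreAux) (ω : Ω) :
    (R.preSub X Y).at ω = max (X.at ω - Y.at ω) 0 := rfl

theorem preAbsDiff_at (X Y : R.PreAux) (ω : Ω) :
    (R.preAbsDiff X Y).at ω = |X.at ω - Y.at ω| := rfl

theorem preZero_at (ω : Ω) : R.preZero.at ω = 0 := rfl

variable {R} in
theorem PreAux.ext_at {X Y : R.PreAux} (h : ∀ ω, X.at ω = Y.at ω) : X = Y := by
  cases X; cases Y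
  exact congrArg PreAux.mk (Subtype.ext <| funext fun ω => Subtype.ext (h ω))

noncomputable instance : PseudoMetricSpace R.PreMain where
  dist a b := R.E (R.preRdist a b).val
  dist_self a := R.integration.E_zero fun ω => dist_self (a.at ω)
  dist_comm a b := by
    have : R.preRdist a b = R.preRdist b a := PreAux.ext_at fun ω => by
      rw [preRdist_at, preRdist_at, dist_comm]
    simp only [this]
  dist_triangle a b c := R.integration.E_le_add fun ω => dist_triangle (a.at ω) (b.at ω) (c.at ω)

noncomputable instance : PseudoMetricSpace R.PreAux where
  dist X Y := R.E (R.preAbsDiff X Y).val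
  dist_self X := R.integration.E_zero fun ω => by
    change |X.at ω - X.at ω| = 0
    rw [sub_self, abs_zero]
  dist_comm X Y := by
    have : R.preAbsDiff X Y = R.preAbsDiff Y X := PreAux.ext_at fun ω => by
      rw [preAbsDiff_at, preAbsDiff_at, abs_sub_comm]
    simp only [this]
  dist_triangle X Y Z := R.integration.E_le_add fun ω => abs_sub_le (X.at ω) (Y.at ω) (Z.at ω)

theorem dist_preMain (a b : R.PreMain) : dist a b = (R.E (R.preRdist a b).val : ℝ) := rfl

theorem dist_preAux (X Y : R.PreAux) : dist X Y = (R.E (R.preAbsDiff X Y).val : ℝ) := rfl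

theorem dist_preZero (X : R.PreAux) : dist X R.preZero = (R.E X.val : ℝ) := by
  have : R.preAbsDiff X R.preZero = X := PreAux.ext_at fun ω => by
    rw [preAbsDiff_at, preZero_at, sub_zero, abs_of_nonneg (X.at_nonneg ω)]
  rw [dist_preAux, this]

theorem preAux_dist_le {X Y X' Y' : R.PreAux}
    (h : ∀ ω, |X.at ω - Y.at ω| ≤ |X'.at ω - Y'.at ω|) : dist X Y ≤ dist X' Y' :=
  R.integration.E_mono h

theorem preSub_dist_left (X Y Z : R.PreAux) : dist (R.preSub X Z) (R.preSub Y Z) ≤ dist X Y :=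
  R.preAux_dist_le fun ω => by
    simp only [preSub_at]
    refine (abs_max_sub_max_le_abs _ _ _).trans ?_
    simp

theorem preSub_dist_right (X Y Z : R.PreAux) : dist (R.preSub Z X) (R.preSub Z Y) ≤ dist X Y :=
  R.preAux_dist_le fun ω => by
    simp only [preSub_at]
    refine (abs_max_sub_max_le_abs _ _ _).trans ?_
    rw [sub_sub_sub_cancel_left, abs_sub_comm]

theorem preRdist_dist_left (a b c : R.PreMain) :
    dist (R.preRdist a c) (R.preRdist b c) ≤ dist a b :=
  R.integration.E_mono fun ω => abs_dist_sub_le (a.at ω) (b.at ω) (c.at ω)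

theorem preRdist_dist_right (a b c : R.PreMain) :
    dist (R.preRdist c a) (R.preRdist c b) ≤ dist a b := by
  have hc : ∀ a b, R.preRdist a b = R.preRdist b a := fun a b => PreAux.ext_at fun ω => by
    rw [preRdist_at, preRdist_at, dist_comm]
  rw [hc c a, hc c b]
  exact R.preRdist_dist_left a b c

theorem update_at {n : ℕ} (a : Fin n → R.PreMain) (i : Fin n) (b : R.PreMain) (ω : Ω) :
    (fun j => (Function.update a i b j).at ω) = Function.update (fun j => (a j).at ω) i (b.at ω) := by
  funext j
  by_cases hj : j = i
  · subst hj; simp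
  · simp [hj]

theorem preFunc_mod (f : L.Func) :
    RespectsModuli (fun i => randMod (L.modF f i)) (R.preFunc f) := by
  intro i ε hε a b c hbc
  refine R.integration.E_le_of_modulus hε (L.modF_pos f i (ε / 4) (by linarith))
    (fun ω hω => ?_) hbc
  have := (ℳ ω).func_mod f i (ε / 4) (by linarith) (fun j => (a j).at ω) (b.at ω) (c.at ω) hω
  rw [← update_at, ← update_at] at this
  exact this

theorem prePred_mod (P : L.Pred) :
    RespectsModuli (fun i => randMod (L.modP P i)) (R.prePred P) := by
  intro i ε hε a b c hbc
  refine R.integration.E_le_of_modulus hε (L.modP_pos P i (ε / 4) (by linarith))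
    (fun ω hω => ?_) hbc
  have := (ℳ ω).pred_mod P i (ε / 4) (by linarith) (fun j => (a j).at ω) (b.at ω) (c.at ω) hω
  rw [← update_at, ← update_at] at this
  exact this

end Randomisation

/-! ### Extension to completions -/

section Extension

variable {X : Type u} {Y : Type v} [PseudoMetricSpace X] [MetricSpace Y] {n : ℕ}

theorem RespectsModuli.uniformContinuous {Y : Type v} [PseudoMetricSpace Y]
    {δ : Fin n → ℝ → ℝ} {g : (Fin n → X) → Y}
    (hg : RespectsModuli δ g) (hδ : ∀ i ε, 0 < ε → 0 < δ i ε) : UniformContinuous g := by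
  classical
  rw [Metric.uniformContinuous_iff]
  intro ε hε
  set ε' := ε / (n + 1) with hε'
  have hε'0 : 0 < ε' := by positivity
  obtain ⟨η, hη0, hη⟩ : ∃ η > 0, ∀ i, η ≤ δ i ε' := by
    rcases isEmpty_or_nonempty (Fin n) with h | h
    · exact ⟨1, one_pos, fun i => (IsEmpty.false i).elim⟩
    · exact ⟨Finset.univ.inf' Finset.univ_nonempty fun i => δ i ε',
        (Finset.lt_inf'_iff _).2 fun i _ => hδ i _ hε'0,
        fun i => Finset.inf'_le _ (Finset.mem_univ i)⟩
  refine ⟨η, hη0, fun {a b} hab => ?_⟩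
  have key : ∀ s : Finset (Fin n), dist (g a) (g (s.piecewise b a)) ≤ s.card * ε' := by
    intro s
    induction s using Finset.induction_on with
    | empty => simp
    | insert i s hi ih =>
      rw [Finset.card_insert_of_notMem hi, Finset.piecewise_insert]
      have h1 := hg i ε' hε'0 (s.piecewise b a) (a i) (b i)
        (((dist_le_pi_dist a b i).trans_lt hab).trans_le (hη i))
      have h2 : Function.update (s.piecewise b a) i (a i) = s.piecewise b a := by
        rw [Function.update_eq_self_iff]; simp [hi]
      rw [h2] at h1
      have := dist_triangle (g a) (g (s.piecewise b a)) (g (Function.update (s.piecewise b a) i (b i)))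
      push_cast
      linarith
  have := key Finset.univ
  rw [Finset.piecewise_univ, Finset.card_univ, Fintype.card_fin] at this
  refine this.trans_lt ?_
  rw [hε', mul_div_assoc', div_lt_iff₀ (by positivity)]
  linarith

theorem isUniformInducing_tuple (X : Type u) [PseudoMetricSpace X] (n : ℕ) :
    IsUniformInducing (Pi.map fun (_ : Fin n) (a : X) => (a : Completion X)) :=
  (Isometry.piMap (fun _ (a : X) => (a : Completion X))
    fun _ => Completion.coe_isometry).isUniformInducing

theorem denseRange_tuple (X : Type u) [PseudoMetricSpace X] (n : ℕ) :
    DenseRange (Pi.map fun (_ : Fin n) (a : X) => (a : Completion X)) :=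
  DenseRange.piMap fun _ => Completion.denseRange_coe

/-- The continuous extension to the completion of a uniformly continuous map on `n`-tuples. -/
noncomputable def extendTuple (g : (Fin n → X) → Y) : (Fin n → Completion X) → Y :=
  ((isUniformInducing_tuple X n).isDenseInducing (denseRange_tuple X n)).extend g

theorem extendTuple_coe {g : (Fin n → X) → Y} (hg : UniformContinuous g) (a : Fin n → X) :
    extendTuple g (fun i => (a i : Completion X)) = g a :=
  uniformly_extend_of_ind (isUniformInducing_tuple X n) (denseRange_tuple X n) hg a

theorem RespectsModuli.extendTuple [CompleteSpace Y] {δ : Fin n → ℝ → ℝ} {g : (Fin n → X) → Y}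
    (hg : RespectsModuli δ g) (hδ : ∀ i ε, 0 < ε → 0 < δ i ε) :
    RespectsModuli δ (extendTuple g) := by
  intro i ε hε a b c
  have huc := hg.uniformContinuous hδ
  have hcont : Continuous (ContLogic.extendTuple g) :=
    (uniformContinuous_uniformly_extend (isUniformInducing_tuple X n)
      (denseRange_tuple X n) huc).continuous
  have hd : DenseRange (Prod.map (Pi.map fun (_ : Fin n) (a : X) => (a : Completion X))
      (Prod.map (fun a : X => (a : Completion X)) fun a : X => (a : Completion X))) :=
    (denseRange_tuple X n).prodMap (Completion.denseRange_coe.prodMap Completion.denseRange_coe)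
  have hcl : IsClosed {p : (Fin n → Completion X) × Completion X × Completion X |
      δ i ε ≤ dist p.2.1 p.2.2 ∨
      dist (ContLogic.extendTuple g (Function.update p.1 i p.2.1))
        (ContLogic.extendTuple g (Function.update p.1 i p.2.2)) ≤ ε} := by
    have h1 : Continuous fun p : (Fin n → Completion X) × Completion X × Completion X =>
        dist (ContLogic.extendTuple g (Function.update p.1 i p.2.1))
          (ContLogic.extendTuple g (Function.update p.1 i p.2.2)) :=
      (hcont.comp (continuous_fst.update i (by fun_prop))).dist
      (hcont.comp (continuous_fst.update i (by fun_prop)))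
    have h2 : Continuous fun p : (Fin n → Completion X) × Completion X × Completion X =>
        dist p.2.1 p.2.2 := by fun_prop
    exact (isClosed_le continuous_const h2).union (isClosed_le h1 continuous_const)
  have h := hd.induction_on (p := fun p => δ i ε ≤ dist p.2.1 p.2.2 ∨
      dist (ContLogic.extendTuple g (Function.update p.1 i p.2.1))
        (ContLogic.extendTuple g (Function.update p.1 i p.2.2)) ≤ ε) (a, b, c) hcl (by
    rintro ⟨a, b, c⟩
    by_cases hbc : δ i ε ≤ dist b c
    · left; simpa using hbc
    · right
      push Not at hbc
      have hu : ∀ z : X, Function.update (fun j => (a j : Completion X)) i (z : Completion X) =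
          fun j => ((Function.update a i z j : X) : Completion X) := by
        intro z; funext j
        by_cases hj : j = i
        · subst hj; simp
        · simp [hj]
      change dist (ContLogic.extendTuple g (Function.update (fun j => (a j : Completion X)) i
        (b : Completion X))) (ContLogic.extendTuple g (Function.update
        (fun j => (a j : Completion X)) i (c : Completion X))) ≤ ε
      rw [hu, hu, extendTuple_coe huc, extendTuple_coe huc]
      exact hg i ε hε a b c hbc)
  intro hbc
  exact h.resolve_left (not_le.2 hbc)

end Extension

theorem randMod_pos {δ : ℝ → ℝ} (hδ : ∀ ε, 0 < ε → 0 < δ ε) (ε : ℝ) (hε : 0 < ε) :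
    0 < randMod δ ε := by
  have := hδ (ε / 4) (by linarith)
  have h : 0 < min (δ (ε / 4)) 1 := lt_min this one_pos
  unfold randMod
  positivity

theorem uniformContinuous₂_of_dist_le {X : Type u} {Y : Type v} {Z : Type w} [PseudoMetricSpace X]
    [PseudoMetricSpace Y] [PseudoMetricSpace Z] {g : X → Y → Z}
    (h1 : ∀ a b c, dist (g a c) (g b c) ≤ dist a b)
    (h2 : ∀ a b c, dist (g c a) (g c b) ≤ dist a b) : UniformContinuous₂ g := by
  have : LipschitzWith 2 (Function.uncurry g) := LipschitzWith.of_dist_le_mul fun p q => by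
    have e1 := dist_triangle (g p.1 p.2) (g q.1 p.2) (g q.1 q.2)
    have e2 := h1 p.1 q.1 p.2
    have e3 := h2 p.2 q.2 q.1
    have e4 : dist p.1 q.1 ≤ dist p q := le_max_left _ _
    have e5 : dist p.2 q.2 ≤ dist p q := le_max_right _ _
    change dist (g p.1 p.2) (g q.1 q.2) ≤ 2 * dist p q
    linarith
  exact this.uniformContinuous

/-! ### The structure associated to a randomisation -/

namespace Randomisation

variable {L : Signature.{u, v}} {Ω : Type w} {ℳ : Ω → Struc.{u, v, x} L} (R : Randomisation ℳ)

theorem uc_preSub : UniformContinuous₂ R.preSub :=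
  uniformContinuous₂_of_dist_le R.preSub_dist_left R.preSub_dist_right

theorem uc_preRdist : UniformContinuous₂ R.preRdist :=
  uniformContinuous₂_of_dist_le R.preRdist_dist_left R.preRdist_dist_right

theorem lip_preNeg : LipschitzWith 1 R.preNeg := LipschitzWith.mk_one fun X Y =>
  R.preAux_dist_le fun ω => by
    simp only [preNeg_at]
    rw [sub_sub_sub_cancel_left, abs_sub_comm]

theorem lip_preHalf : LipschitzWith 1 R.preHalf := LipschitzWith.mk_one fun X Y =>
  R.preAux_dist_le fun ω => by
    simp only [preHalf_at]
    rw [← sub_div, abs_div, abs_of_pos (by norm_num : (0 : ℝ) < 2)]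
    linarith [abs_nonneg (X.at ω - Y.at ω)]

theorem coe_sub (X Y : R.PreAux) :
    Completion.map₂ R.preSub (X : Completion R.PreAux) (Y : Completion R.PreAux) =
      ((R.preSub X Y : R.PreAux) : Completion R.PreAux) :=
  Completion.map₂_coe_coe _ _ _ R.uc_preSub

theorem coe_neg (X : R.PreAux) : Completion.map R.preNeg (X : Completion R.PreAux) =
    ((R.preNeg X : R.PreAux) : Completion R.PreAux) :=
  Completion.map_coe R.lip_preNeg.uniformContinuous _

theorem coe_half (X : R.PreAux) : Completion.map R.preHalf (X : Completion R.PreAux) =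
    ((R.preHalf X : R.PreAux) : Completion R.PreAux) :=
  Completion.map_coe R.lip_preHalf.uniformContinuous _

theorem continuous_sub {Z : Type y} [TopologicalSpace Z] {g h : Z → Completion R.PreAux}
    (hg : Continuous g) (hh : Continuous h) :
    Continuous fun z => Completion.map₂ R.preSub (g z) (h z) :=
  Completion.continuous_map₂ hg hh

theorem continuous_neg : Continuous (Completion.map R.preNeg) := Completion.continuous_map

theorem continuous_half : Continuous (Completion.map R.preHalf) := Completion.continuous_map

/-- The auxiliary sort of the structure associated to a randomisation: the completion of `A` for
the `L¹` pseudo-metric. -/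
noncomputable def assocAux : RVModel.{w} where
  carrier := Completion R.PreAux
  dist_le_one a b := Completion.induction_on₂ a b (isClosed_le (by fun_prop) continuous_const)
    fun a b => by rw [Completion.dist_eq]; exact (R.E _).2.2
  zero := (R.preZero : Completion R.PreAux)
  neg := Completion.map R.preNeg
  half := Completion.map R.preHalf
  sub := Completion.map₂ R.preSub
  dist_neg_le a b := by
    simpa using R.lip_preNeg.completion_map.dist_le_mul a b
  dist_half_le a b := by
    simpa using R.lip_preHalf.completion_map.dist_le_mul a b
  dist_sub_left_le a b c := Completion.induction_on₃ a b c
    (isClosed_le ((R.continuous_sub (by fun_prop) (by fun_prop)).dist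
      (R.continuous_sub (by fun_prop) (by fun_prop))) (by fun_prop))
    fun a b c => by
      simp only [coe_sub, Completion.dist_eq]; exact R.preSub_dist_left a b c
  dist_sub_right_le a b c := Completion.induction_on₃ a b c
    (isClosed_le ((R.continuous_sub (by fun_prop) (by fun_prop)).dist
      (R.continuous_sub (by fun_prop) (by fun_prop))) (by fun_prop))
    fun a b c => by
      simp only [coe_sub, Completion.dist_eq]; exact R.preSub_dist_right a b c
  rv1 a b := Completion.induction_on₂ a b
    (isClosed_eq (by fun_prop)
      (((R.continuous_sub (by fun_prop) (by fun_prop)).dist continuous_const).add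
        ((R.continuous_sub (by fun_prop) (R.continuous_sub (by fun_prop) (by fun_prop))).dist
          continuous_const)))
    fun a b => by
      simp only [coe_sub, Completion.dist_eq, dist_preZero]
      exact R.integration.E_meet a.val b.val
  rv2 := by
    rw [coe_neg, Completion.dist_eq, dist_preZero, R.integration.E_one _ fun ω => ?_]
    · rfl
    · apply Subtype.ext
      change (R.preNeg R.preZero).at ω = 1
      rw [preNeg_at, preZero_at, sub_zero]
  rv3 a b := Completion.induction_on₂ a b
    (isClosed_eq (by fun_prop)
      (((R.continuous_sub (by fun_prop) (by fun_prop)).dist continuous_const).add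
        ((R.continuous_sub (by fun_prop) (by fun_prop)).dist continuous_const)))
    fun a b => by
      simp only [coe_sub, Completion.dist_eq, dist_preZero]
      refine R.integration.E_add _ _ _ fun ω => ?_
      change (R.preAbsDiff a b).at ω = (R.preSub a b).at ω + (R.preSub b a).at ω
      rw [preAbsDiff_at, preSub_at, preSub_at]
      rcases le_total (a.at ω) (b.at ω) with hxy | hxy
      · rw [max_eq_right (by linarith), max_eq_left (by linarith), abs_of_nonpos (by linarith)]
        ring
      · rw [max_eq_left (by linarith), max_eq_right (by linarith), abs_of_nonneg (by linarith)]
        ring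
  rv4_1 a b := Completion.induction_on₂ a b
    (isClosed_eq (R.continuous_sub (R.continuous_sub (by fun_prop) (by fun_prop)) (by fun_prop))
      continuous_const)
    fun a b => by
      simp only [coe_sub]
      refine congrArg _ (PreAux.ext_at fun ω => ?_)
      simp only [preSub_at, preZero_at]
      have ha := a.at_nonneg ω
      have hb := b.at_nonneg ω
      grind
  rv4_2 a b c := Completion.induction_on₃ a b c
    (isClosed_eq (R.continuous_sub (R.continuous_sub (R.continuous_sub (by fun_prop) (by fun_prop))
      (R.continuous_sub (by fun_prop) (by fun_prop)))
      (R.continuous_sub (by fun_prop) (by fun_prop))) continuous_const)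
    fun a b c => by
      simp only [coe_sub]
      refine congrArg _ (PreAux.ext_at fun ω => ?_)
      simp only [preSub_at, preZero_at]
      grind
  rv4_3 a b := Completion.induction_on₂ a b
    (isClosed_eq (R.continuous_sub
      (R.continuous_sub (by fun_prop) (R.continuous_sub (by fun_prop) (by fun_prop)))
      (R.continuous_sub (by fun_prop) (R.continuous_sub (by fun_prop) (by fun_prop))))
      continuous_const)
    fun a b => by
      simp only [coe_sub]
      refine congrArg _ (PreAux.ext_at fun ω => ?_)
      simp only [preSub_at, preZero_at]
      have ha := a.at_nonneg ω
      have hb := b.at_nonneg ω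
      grind
  rv4_4 a b := Completion.induction_on₂ a b
    (isClosed_eq (R.continuous_sub (R.continuous_sub (by fun_prop) (by fun_prop))
      (R.continuous_sub (R.continuous_neg.comp continuous_snd)
        (R.continuous_neg.comp continuous_fst))) continuous_const)
    fun a b => by
      simp only [coe_sub, coe_neg]
      refine congrArg _ (PreAux.ext_at fun ω => ?_)
      simp only [preSub_at, preZero_at, preNeg_at]
      grind
  rv4_5 a := Completion.induction_on a
    (isClosed_eq (R.continuous_sub R.continuous_half
      (R.continuous_sub (by fun_prop) R.continuous_half)) continuous_const)
    fun a => by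
      simp only [coe_sub, coe_half]
      refine congrArg _ (PreAux.ext_at fun ω => ?_)
      simp only [preSub_at, preZero_at, preHalf_at]
      have ha := a.at_nonneg ω
      grind
  rv4_6 a := Completion.induction_on a
    (isClosed_eq (R.continuous_sub (R.continuous_sub (by fun_prop) R.continuous_half)
      R.continuous_half) continuous_const)
    fun a => by
      simp only [coe_sub, coe_half]
      refine congrArg _ (PreAux.ext_at fun ω => ?_)
      simp only [preSub_at, preZero_at, preHalf_at]
      have ha := a.at_nonneg ω
      grind

theorem coe_rdist (a b : R.PreMain) :
    Completion.map₂ R.preRdist (a : Completion R.PreMain) (b : Completion R.PreMain) =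
      ((R.preRdist a b : R.PreAux) : Completion R.PreAux) :=
  Completion.map₂_coe_coe _ _ _ R.uc_preRdist

/-- The class map from a pre-structure to its completion is an isometry, so it preserves moduli. -/
theorem coe_mod {X : Type u} {Y : Type v} [PseudoMetricSpace X] [PseudoMetricSpace Y] {n : ℕ}
    {δ : Fin n → ℝ → ℝ} {g : (Fin n → X) → Y} (hg : RespectsModuli δ g) :
    RespectsModuli δ fun a => (g a : Completion Y) := fun i ε hε a b c hbc => by
  rw [Completion.dist_eq]; exact hg i ε hε a b c hbc

/-- The structure associated to a randomisation: the completion of its pre-structure, on which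
all symbols are interpreted by continuous extension. -/
noncomputable def assoc : RandStruc.{u, v, max w x, w} L where
  main := Completion R.PreMain
  nonempty := ⟨((⟨⟨R.nonempty.some, R.nonempty.some_mem⟩⟩ : R.PreMain) : Completion R.PreMain)⟩
  main_dist_le_one a b := Completion.induction_on₂ a b
    (isClosed_le (by fun_prop) continuous_const)
    fun a b => by rw [Completion.dist_eq]; exact (R.E _).2.2
  aux := R.assocAux
  func f := extendTuple fun a => (R.preFunc f a : Completion R.PreMain)
  pred P := extendTuple fun a => (R.prePred P a : Completion R.PreAux)
  rdist := Completion.map₂ R.preRdist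
  func_mod f := (coe_mod (R.preFunc_mod f)).extendTuple
    fun i => randMod_pos (L.modF_pos f i)
  pred_mod P := (coe_mod (R.prePred_mod P)).extendTuple
    fun i => randMod_pos (L.modP_pos P i)
  dist_rdist_left_le a b c := Completion.induction_on₃ a b c
    (isClosed_le ((Completion.continuous_map₂ (by fun_prop) (by fun_prop)).dist
      (Completion.continuous_map₂ (by fun_prop) (by fun_prop))) (by fun_prop))
    fun a b c => by
      simp only [coe_rdist, Completion.dist_eq]
      exact (Completion.dist_eq _ _).trans_le (R.preRdist_dist_left a b c)
  dist_rdist_right_le a b c := Completion.induction_on₃ a b c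
    (isClosed_le ((Completion.continuous_map₂ (by fun_prop) (by fun_prop)).dist
      (Completion.continuous_map₂ (by fun_prop) (by fun_prop))) (by fun_prop))
    fun a b c => by
      simp only [coe_rdist, Completion.dist_eq]
      exact (Completion.dist_eq _ _).trans_le (R.preRdist_dist_right a b c)

/-- The canonical map `[·]` from `M` to the main sort of the associated structure. -/
noncomputable def mainClass (a : R.M) : R.assoc.main :=
  ((⟨a⟩ : R.PreMain) : Completion R.PreMain)

/-- The canonical map `[·]` from `A` to the auxiliary sort of the associated structure. -/
noncomputable def auxClass (X : R.A) : R.assoc.aux.carrier :=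
  ((⟨X⟩ : R.PreAux) : Completion R.PreAux)

end Randomisation

end ContLogic

namespace ContLogic

open Filter Topology UniformSpace

/-! The second claim is proved by induction on `φ` in a stronger form, `IsExtension`: the
interpretation of `φ` on the completion is uniformly continuous, and it agrees with the class of
`⟨φ(a)⟩` when `a` comes from actual sections. Atomic formulas satisfy this because symbols are
interpreted by continuous extension, and the connectives because they are Lipschitz and commute with
classes.

The substance is the infimum, since a lattice infimum over the completion has no evident relation to
infima taken at each `ω`. The candidate for its value is the continuous extension `V` of the map
sending `a` to the class of `⟨inf φ(a)⟩`. It exists by `uniformContinuous_bracketClass`: a formula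
has a modulus common to all structures (`exists_formula_modulus`), and a pointwise modulus
integrates to one for the `L¹` distances (`IsIntegrationSpace.E_le_of_modulus`).

`IsExtension.isGLB` shows that `V(a)` is the greatest lower bound at every point `a` of the
completion. Being a lower bound is a closed condition, so it is enough to check it on sections,
where it holds pointwise. For the converse, approximate `a` by a tuple `c` of sections and choose
for each `ω` a near-minimiser `b(ω)`. Every choice function is a section of the product, so `b` is
available as a witness, and `φ(a,b)` has value close to `V(a)`. If `w` is another lower bound, then
`E(w ∸ V(a))` is at most this distance, hence zero. All errors are uniform in `ω`, so finite
additivity of `E` suffices.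

Suprema follow by duality through negation. Fullness is gluing of sections by cases at each `ω`. -/

/-! ### Moduli and distances of finite tuples -/

theorem exists_pos_forall_le {ι : Type u} [Finite ι] {f : ι → ℝ} (hf : ∀ i, 0 < f i) :
    ∃ η > 0, ∀ i, η ≤ f i := by
  cases nonempty_fintype ι
  rcases isEmpty_or_nonempty ι with h | h
  · exact ⟨1, one_pos, fun i => (IsEmpty.false i).elim⟩
  · exact ⟨Finset.univ.inf' Finset.univ_nonempty f, (Finset.lt_inf'_iff _).2 fun i _ => hf i,
      fun i => Finset.inf'_le _ (Finset.mem_univ i)⟩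

/-- Maps respecting common moduli are uniformly equicontinuous, uniformly over all spaces. -/
theorem exists_modulus {n : ℕ} {δ : Fin n → ℝ → ℝ} (hδ : ∀ i ε, 0 < ε → 0 < δ i ε) {ε : ℝ}
    (hε : 0 < ε) : ∃ η > 0, ∀ {X : Type u} {Y : Type v} [PseudoMetricSpace X]
      [PseudoMetricSpace Y] {g : (Fin n → X) → Y}, RespectsModuli δ g →
      ∀ a b, dist a b < η → dist (g a) (g b) < ε := by
  classical
  -- Dividing by `n + 1` instead of `n` covers `n = 0` and keeps the sum of the `n` errors strictly
  -- below `ε`.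
  set ε' := ε / (n + 1) with hε'
  have hε'0 : 0 < ε' := by positivity
  obtain ⟨η, hη0, hη⟩ := exists_pos_forall_le fun i => hδ i ε' hε'0
  refine ⟨η, hη0, fun {X Y} _ _ {g} hg a b hab => ?_⟩
  -- The coordinates are switched from `a` to `b` one at a time; each switch costs at most `ε'`.
  have key : ∀ s : Finset (Fin n), dist (g a) (g (s.piecewise b a)) ≤ s.card * ε' := by
    intro s
    induction s using Finset.induction_on with
    | empty => simp
    | insert i s hi ih =>
      rw [Finset.card_insert_of_notMem hi, Finset.piecewise_insert]
      have h1 := hg i ε' hε'0 (s.piecewise b a) (a i) (b i)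
        (((dist_le_pi_dist a b i).trans_lt hab).trans_le (hη i))
      have h2 : Function.update (s.piecewise b a) i (a i) = s.piecewise b a := by
        rw [Function.update_eq_self_iff]; simp [hi]
      rw [h2] at h1
      have := dist_triangle (g a) (g (s.piecewise b a)) (g (Function.update (s.piecewise b a) i (b i)))
      push_cast
      linarith
  have := key Finset.univ
  rw [Finset.piecewise_univ, Finset.card_univ, Fintype.card_fin] at this
  refine this.trans_lt ?_
  rw [hε', mul_div_assoc', div_lt_iff₀ (by positivity)]
  linarith

theorem dist_update_le {X : Type u} [PseudoMetricSpace X] {n : ℕ} (a : Fin n → X) (i : Fin n)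
    (b c : X) : dist (Function.update a i b) (Function.update a i c) ≤ dist b c := by
  refine (dist_pi_le_iff dist_nonneg).2 fun j => ?_
  by_cases hj : j = i
  · subst hj; simp
  · simp [hj]

theorem dist_snoc_lt {X : Type u} [PseudoMetricSpace X] {n : ℕ} {a b : Fin n → X} {η : ℝ}
    (h : dist a b < η) (c : X) :
    dist (Fin.snoc a c : Fin (n + 1) → X) (Fin.snoc b c) < η := by
  refine (dist_pi_lt_iff (dist_nonneg.trans_lt h)).2 fun j => ?_
  refine Fin.lastCases ?_ (fun i => ?_) j
  · simpa using dist_nonneg.trans_lt h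
  · simpa using (dist_le_pi_dist a b i).trans_lt h

/-! ### Quantifiers on the unit interval -/

theorem uneg_uneg (s : unitInterval) : uneg (uneg s) = s := Subtype.ext (by simp [uneg])

theorem uneg_anti {s t : unitInterval} (h : s ≤ t) : uneg t ≤ uneg s :=
  sub_le_sub_left (α := ℝ) h 1

/-- Negation is an order-reversing involution, so it exchanges infima and suprema. This reduces
every statement about `sup` to one about `inf`. -/
theorem uneg_iInf_uneg {ι : Type u} (f : ι → unitInterval) :
    uneg (⨅ i, uneg (f i)) = ⨆ i, f i := by
  refine le_antisymm ?_ (iSup_le fun i => ?_)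
  · have : uneg (⨆ i, f i) ≤ ⨅ i, uneg (f i) := le_iInf fun i => uneg_anti (le_iSup f i)
    simpa only [uneg_uneg] using uneg_anti this
  · simpa only [uneg_uneg] using uneg_anti (iInf_le (fun i => uneg (f i)) i)

/-- Near-minimisers exist because `[0,1]` has no room for a larger lower bound. They are later
chosen at each `ω` to build a section. -/
theorem exists_lt_iInf_add {ι : Type u} [Nonempty ι] (g : ι → unitInterval) {η : ℝ} (hη : 0 < η) :
    ∃ i, (g i : ℝ) < (⨅ i, g i : unitInterval) + η := by
  by_contra! hcon
  obtain ⟨i⟩ := ‹Nonempty ι›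
  -- A single index already shows that the infimum plus `η` is still a truth value; it is then a
  -- lower bound exceeding the infimum.
  have hle : (⨅ i, g i : unitInterval) + η ≤ 1 := (hcon i).trans (g i).2.2
  have : (⟨(⨅ i, g i : unitInterval) + η, by
    linarith [(⨅ i, g i : unitInterval).2.1], hle⟩ : unitInterval) ≤ ⨅ i, g i :=
    le_iInf fun i => hcon i
  have h' : ((⨅ i, g i : unitInterval) : ℝ) + η ≤ (⨅ i, g i : unitInterval) := this
  linarith

/-- Evaluating at a near-minimiser of `g` gives the bound up to an arbitrary `η`. Used in both
directions, it makes infima 1-Lipschitz for the uniform distance. -/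
theorem iInf_le_iInf_add {ι : Type u} [Nonempty ι] {f g : ι → unitInterval} {ε : ℝ}
    (h : ∀ i, (f i : ℝ) ≤ g i + ε) :
    ((⨅ i, f i : unitInterval) : ℝ) ≤ (⨅ i, g i : unitInterval) + ε := by
  refine le_of_forall_pos_lt_add fun η hη => ?_
  obtain ⟨i, hi⟩ := exists_lt_iInf_add g hη
  have h1 : ((⨅ i, f i : unitInterval) : ℝ) ≤ f i := iInf_le f i
  linarith [h i]

theorem dist_iInf_le {ι : Type u} [Nonempty ι] {f g : ι → unitInterval} {ε : ℝ}
    (h : ∀ i, dist (f i) (g i) ≤ ε) : dist (⨅ i, f i) (⨅ i, g i) ≤ ε := by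
  have h' : ∀ i, |(f i : ℝ) - g i| ≤ ε := h
  change |((⨅ i, f i : unitInterval) : ℝ) - (⨅ i, g i : unitInterval)| ≤ ε
  have h1 := iInf_le_iInf_add (f := f) (g := g) (ε := ε) fun i => by linarith [(abs_le.1 (h' i)).2]
  have h2 := iInf_le_iInf_add (f := g) (g := f) (ε := ε) fun i => by linarith [(abs_le.1 (h' i)).1]
  exact abs_le.2 ⟨by linarith, by linarith⟩

theorem dist_uneg (s t : unitInterval) : dist (uneg s) (uneg t) = dist s t := by
  change |(1 - (s : ℝ)) - (1 - t)| = |(s : ℝ) - t|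
  rw [sub_sub_sub_cancel_left, abs_sub_comm]

theorem dist_uhalf_le (s t : unitInterval) : dist (uhalf s) (uhalf t) ≤ dist s t := by
  change |(s : ℝ) / 2 - t / 2| ≤ |(s : ℝ) - t|
  rw [← sub_div, abs_div, abs_of_pos (by norm_num : (0 : ℝ) < 2)]
  linarith [abs_nonneg ((s : ℝ) - t)]

theorem dist_usub_le (s s' t t' : unitInterval) :
    dist (usub s t) (usub s' t') ≤ dist s s' + dist t t' := by
  change |max ((s : ℝ) - t) 0 - max ((s' : ℝ) - t') 0| ≤ |(s : ℝ) - s'| + |(t : ℝ) - t'|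
  refine (abs_max_sub_max_le_abs _ _ _).trans ?_
  have : (s : ℝ) - t - (s' - t') = (s - s') - (t - t') := by ring
  rw [this]
  exact abs_sub _ _

/-! ### Uniform continuity of formulas, uniformly over all structures -/

/-- The radius is built from the moduli of the signature alone, so it is fixed before the structure
is named. -/
theorem Term.exists_modulus {L : Signature.{u, v}} {n : ℕ} (t : Term L (Fin n)) {ε : ℝ}
    (hε : 0 < ε) : ∃ η > 0, ∀ (𝓜 : Struc.{u, v, w} L) (a b : Fin n → 𝓜.carrier),
      dist a b < η → dist (t.eval 𝓜.func a) (t.eval 𝓜.func b) < ε := by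
  induction t generalizing ε with
  | var i => exact ⟨ε, hε, fun 𝓜 a b h => (dist_le_pi_dist a b i).trans_lt h⟩
  | app f ts ih =>
    obtain ⟨η, hη, h⟩ := ContLogic.exists_modulus.{w, w} (L.modF_pos f) hε
    choose ζ hζ hts using fun j => ih j hη
    obtain ⟨θ, hθ, hθζ⟩ := exists_pos_forall_le hζ
    exact ⟨θ, hθ, fun 𝓜 a b hab => h (𝓜.func_mod f) _ _ <| (dist_pi_lt_iff hη).2 fun j =>
      hts j 𝓜 a b (hab.trans_le (hθζ j))⟩

/-- A quantifier keeps the radius of its body: adjoining the same last coordinate to two tuples does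
not move them apart, and infima are 1-Lipschitz. The final inequality is not strict because infima
do not preserve strict bounds. -/
theorem exists_formula_modulus {L : Signature.{u, v}} {n : ℕ} (φ : Formula L n) {ε : ℝ}
    (hε : 0 < ε) : ∃ η > 0, ∀ (𝓜 : Struc.{u, v, w} L) (a b : Fin n → 𝓜.carrier),
      dist a b < η → dist (𝓜.value φ a) (𝓜.value φ b) ≤ ε := by
  induction φ generalizing ε with
  | pred P ts =>
    obtain ⟨η, hη, h⟩ := ContLogic.exists_modulus.{w, 0} (L.modP_pos P) hε
    choose ζ hζ hts using fun j => (ts j).exists_modulus hη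
    obtain ⟨θ, hθ, hθζ⟩ := exists_pos_forall_le hζ
    exact ⟨θ, hθ, fun 𝓜 a b hab => (h (𝓜.pred_mod P) _ _ <| (dist_pi_lt_iff hη).2 fun j =>
      hts j 𝓜 a b (hab.trans_le (hθζ j))).le⟩
  | dist s t =>
    obtain ⟨η, hη, h⟩ := s.exists_modulus (half_pos hε)
    obtain ⟨θ, hθ, h'⟩ := t.exists_modulus (half_pos hε)
    refine ⟨min η θ, lt_min hη hθ, fun 𝓜 a b hab => ?_⟩
    have h1 := h 𝓜 a b (hab.trans_le (min_le_left _ _))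
    have h2 := h' 𝓜 a b (hab.trans_le (min_le_right _ _))
    refine (dist_dist_dist_le _ _ _ _).trans ?_
    linarith
  | neg φ ih =>
    obtain ⟨η, hη, h⟩ := ih hε
    exact ⟨η, hη, fun 𝓜 a b hab => (dist_uneg _ _).trans_le (h 𝓜 a b hab)⟩
  | half φ ih =>
    obtain ⟨η, hη, h⟩ := ih hε
    exact ⟨η, hη, fun 𝓜 a b hab => (dist_uhalf_le _ _).trans (h 𝓜 a b hab)⟩
  | sub φ ψ ihφ ihψ =>
    obtain ⟨η, hη, h⟩ := ihφ (half_pos hε)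
    obtain ⟨θ, hθ, h'⟩ := ihψ (half_pos hε)
    refine ⟨min η θ, lt_min hη hθ, fun 𝓜 a b hab => ?_⟩
    have h1 := h 𝓜 a b (hab.trans_le (min_le_left _ _))
    have h2 := h' 𝓜 a b (hab.trans_le (min_le_right _ _))
    refine (dist_usub_le _ _ _ _).trans ?_
    linarith
  | inf φ ih =>
    obtain ⟨η, hη, h⟩ := ih hε
    exact ⟨η, hη, fun 𝓜 a b hab => dist_iInf_le fun c => h 𝓜 _ _ (dist_snoc_lt hab c)⟩
  | sup φ ih =>
    obtain ⟨η, hη, h⟩ := ih hε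
    refine ⟨η, hη, fun 𝓜 a b hab => ?_⟩
    simp only [Struc.value, ← uneg_iInf_uneg]
    rw [dist_uneg]
    exact dist_iInf_le fun c => (dist_uneg _ _).trans_le (h 𝓜 _ _ (dist_snoc_lt hab c))

/-- Every formula respects moduli which do not depend on the structure. -/
theorem Formula.exists_respectsModuli {L : Signature.{u, v}} {n : ℕ} (φ : Formula L n) :
    ∃ δ : ℝ → ℝ, (∀ ε, 0 < ε → 0 < δ ε) ∧
      ∀ 𝓜 : Struc.{u, v, w} L, RespectsModuli (fun _ => δ) (𝓜.value φ) := by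
  -- The estimate for whole tuples yields one modulus serving every coordinate, since changing one
  -- entry moves a tuple no further than that entry.
  choose! δ hδ h using fun (ε : ℝ) (hε : 0 < ε) => exists_formula_modulus.{u, v, w} φ hε
  exact ⟨δ, hδ, fun 𝓜 i ε hε a b c hbc =>
    h ε hε 𝓜 _ _ ((dist_update_le a i b c).trans_lt hbc)⟩

/-! ### Suprema in models of `RV` -/

/-- Axiom `rv4_4` for the negated elements bounds `¬b ∸ ¬a` by `a ∸ b` once the double negations
cancel. -/
theorem RVModel.neg_anti {A : RVModel.{u}} {a b : A.carrier} (h : a ≤ b) : A.neg b ≤ A.neg a := by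
  have h1 := A.rv4_4 (A.neg b) (A.neg a)
  rw [neg_neg, neg_neg] at h1
  exact A.mp h h1

theorem RVModel.neg_iInf_neg {A : RVModel.{u}} {ι : Type v} (f : ι → A.carrier) :
    A.neg (⨅ i, A.neg (f i)) = ⨆ i, f i := by
  refine le_antisymm ?_ (iSup_le fun i => ?_)
  · have : A.neg (⨆ i, f i) ≤ ⨅ i, A.neg (f i) := le_iInf fun i => neg_anti (le_iSup f i)
    simpa only [neg_neg] using neg_anti this
  · simpa only [neg_neg] using neg_anti (iInf_le (fun i => A.neg (f i)) i)

/-- Since `a ∸ c = 0`, the left side is the distance from `a ∸ b` to `a ∸ c`, and `∸` is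
1-Lipschitz. Thus an element below `c` is almost below anything metrically close to `c`. -/
theorem RVModel.e_sub_le_dist {A : RVModel.{u}} {a b c : A.carrier} (h : a ≤ c) :
    dist (A.sub a b) A.zero ≤ dist c b := by
  have h1 := A.dist_sub_right_le c b a
  rwa [le_def.1 h, dist_comm] at h1

/-! ### The classes of values of formulas -/

theorem _root_.UniformContinuous₂.comp_prodMk {X : Type u} {Y : Type v} {Z : Type w} {W : Type x}
    [UniformSpace X] [UniformSpace Y] [UniformSpace Z] [UniformSpace W] {g : X → Y → Z}
    (hg : UniformContinuous₂ g) {p : W → X} {q : W → Y} (hp : UniformContinuous p)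
    (hq : UniformContinuous q) : UniformContinuous fun a => g (p a) (q a) :=
  UniformContinuous.comp (g := Function.uncurry g) hg (hp.prodMk hq)

theorem RVModel.uniformContinuous₂_sub (A : RVModel.{u}) : UniformContinuous₂ A.sub :=
  uniformContinuous₂_of_dist_le A.dist_sub_left_le A.dist_sub_right_le

namespace Randomisation

variable {L : Signature.{u, v}} {Ω : Type w} {ℳ : Ω → Struc.{u, v, x} L} (R : Randomisation ℳ)

theorem dist_auxClass (X Y : R.A) :
    dist (R.auxClass X) (R.auxClass Y) = (R.E (R.integration.absDiff X Y) : ℝ) :=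
  Completion.dist_eq (⟨X⟩ : R.PreAux) ⟨Y⟩

theorem auxClass_sub (X Y : R.A) :
    R.assoc.aux.sub (R.auxClass X) (R.auxClass Y) = R.auxClass (R.integration.sub X Y) :=
  R.coe_sub ⟨X⟩ ⟨Y⟩

theorem auxClass_neg (X : R.A) :
    R.assoc.aux.neg (R.auxClass X) = R.auxClass (R.integration.neg X) :=
  R.coe_neg ⟨X⟩

theorem auxClass_half (X : R.A) :
    R.assoc.aux.half (R.auxClass X) = R.auxClass (R.integration.half X) :=
  R.coe_half ⟨X⟩

theorem auxClass_le {X Y : R.A} (h : ∀ ω, X.1 ω ≤ Y.1 ω) : R.auxClass X ≤ R.auxClass Y := by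
  rw [RVModel.le_def, auxClass_sub]
  refine congrArg R.auxClass (Subtype.ext <| funext fun ω => Subtype.ext ?_)
  exact max_eq_right (sub_nonpos.2 (h ω))

/-- A uniform pointwise bound is the case of `E_le_of_modulus` with trivial data: the comparison
function `0` and the constant modulus `1`. The factor `4` is inherited from that estimate. -/
theorem dist_auxClass_le {X Y : R.A} {ε : ℝ} (hε : 0 < ε)
    (h : ∀ ω, |(X.1 ω : ℝ) - Y.1 ω| ≤ ε / 4) : dist (R.auxClass X) (R.auxClass Y) ≤ ε := by
  rw [dist_auxClass]
  refine R.integration.E_le_of_modulus (V := R.integration.zero) (δ := fun _ => 1) hε one_pos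
    (fun ω _ => h ω) ?_
  rw [R.integration.E_zero R.integration.zero_val]
  exact randMod_pos (fun _ _ => one_pos) ε hε

/-- The canonical map from the main sort of the pre-structure. -/
noncomputable def toMain (a : R.PreMain) : R.assoc.main := R.mainClass a.val

theorem func_toMain (f : L.Func) (a : Fin (L.arityF f) → R.PreMain) :
    R.assoc.func f (fun i => R.toMain (a i)) = R.toMain (R.preFunc f a) :=
  extendTuple_coe ((coe_mod (R.preFunc_mod f)).uniformContinuous
    fun i => randMod_pos (L.modF_pos f i)) a

theorem pred_toMain (P : L.Pred) (a : Fin (L.arityP P) → R.PreMain) :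
    R.assoc.pred P (fun i => R.toMain (a i)) = R.auxClass (R.prePred P a).val :=
  extendTuple_coe ((coe_mod (R.prePred_mod P)).uniformContinuous
    fun i => randMod_pos (L.modP_pos P i)) a

theorem rdist_toMain (a b : R.PreMain) :
    R.assoc.rdist (R.toMain a) (R.toMain b) = R.auxClass (R.preRdist a b).val :=
  R.coe_rdist a b

theorem denseRange_toMain (n : ℕ) :
    DenseRange fun (a : Fin n → R.PreMain) i => R.toMain (a i) :=
  denseRange_tuple R.PreMain n

theorem snoc_at {n : ℕ} (a : Fin n → R.PreMain) (b : R.PreMain) (ω : Ω) :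
    (fun i => PreMain.at (R := R) (Fin.snoc (α := fun _ => R.PreMain) a b i) ω) =
      (Fin.snoc (fun i => (a i).at ω) (b.at ω) : Fin (n + 1) → (ℳ ω).carrier) := by
  funext i
  refine Fin.lastCases ?_ (fun i => ?_) i <;> simp

theorem snoc_toMain {n : ℕ} (a : Fin n → R.PreMain) (b : R.PreMain) :
    (fun i => R.toMain (Fin.snoc (α := fun _ => R.PreMain) a b i)) =
      (Fin.snoc (fun i => R.toMain (a i)) (R.toMain b) : Fin (n + 1) → R.assoc.main) := by
  funext i
  refine Fin.lastCases ?_ (fun i => ?_) i <;> simp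

theorem eval_toMain {n : ℕ} (t : Term L (Fin n)) (a : Fin n → R.PreMain) :
    t.eval R.assoc.func (fun i => R.toMain (a i)) = R.toMain (t.eval R.preFunc a) := by
  induction t with
  | var i => rfl
  | app f ts ih =>
    simp only [Term.eval, ih]
    exact R.func_toMain f _

theorem eval_preFunc_at {n : ℕ} (t : Term L (Fin n)) (a : Fin n → R.PreMain) (ω : Ω) :
    (t.eval R.preFunc a).at ω = t.eval (ℳ ω).func fun i => (a i).at ω := by
  induction t with
  | var i => rfl
  | app f ts ih =>
    simp only [Term.eval, ← ih]
    rfl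

end Randomisation

/-! ### Uniform continuity of terms, of the distance symbol and of extensions -/

theorem RandStruc.uniformContinuous_eval {L : Signature.{u, v}} (𝓡 : RandStruc.{u, v, w, x} L)
    {n : ℕ} (t : Term L (Fin n)) :
    UniformContinuous fun a : Fin n → 𝓡.main => t.eval 𝓡.func a := by
  induction t with
  | var i => exact Pi.uniformContinuous_proj _ i
  | app f ts ih =>
    exact ((𝓡.func_mod f).uniformContinuous fun i => randMod_pos (L.modF_pos f i)).comp
      (uniformContinuous_pi.2 ih)

theorem RandStruc.uniformContinuous₂_rdist {L : Signature.{u, v}} (𝓡 : RandStruc.{u, v, w, x} L) :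
    UniformContinuous₂ 𝓡.rdist :=
  uniformContinuous₂_of_dist_le 𝓡.dist_rdist_left_le 𝓡.dist_rdist_right_le

section Extension

variable {X : Type u} {Y : Type v} [PseudoMetricSpace X] [MetricSpace Y] {n : ℕ}

theorem uniformContinuous_extendTuple [CompleteSpace Y] {g : (Fin n → X) → Y}
    (hg : UniformContinuous g) : UniformContinuous (extendTuple g) :=
  uniformContinuous_uniformly_extend (isUniformInducing_tuple X n) (denseRange_tuple X n) hg

end Extension

/-! ### Formulas over the product of all sections -/

section Product

variable {L : Signature.{u, v}} {Ω : Type w} (ℳ : Ω → Struc.{u, v, x} L)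
    (E : ↥(Set.univ : Set (Ω → unitInterval)) → unitInterval)
    (hE : IsIntegrationSpace Set.univ E)

/-- The class of `⟨φ(a)⟩` for a tuple of sections. -/
noncomputable def bracketClass {n : ℕ} (φ : Formula L n)
    (a : Fin n → (productRandomisation ℳ E hE).PreMain) :
    (productRandomisation ℳ E hE).assoc.aux.carrier :=
  (productRandomisation ℳ E hE).auxClass ⟨bracket ℳ φ fun i => (a i).at, Set.mem_univ _⟩

/-- The modulus of `φ` is the same in every `ℳ ω`, so it can be integrated over `Ω`. This is what
allows the class of `⟨φ(a)⟩` to be extended to the completion before the value of `φ` there is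
known. -/
theorem uniformContinuous_bracketClass {n : ℕ} (φ : Formula L n) :
    UniformContinuous (bracketClass ℳ E hE φ) := by
  obtain ⟨δ, hδ, h⟩ := φ.exists_respectsModuli.{u, v, x}
  have : RespectsModuli (fun _ => randMod δ) (bracketClass ℳ E hE φ) := by
    intro i ε hε a b c hbc
    rw [bracketClass, bracketClass, Randomisation.dist_auxClass]
    refine hE.E_le_of_modulus (V := ((productRandomisation ℳ E hE).preRdist b c).val) hε
      (hδ (ε / 4) (by linarith)) (fun ω hω => ?_) hbc
    have := h (ℳ ω) i (ε / 4) (by linarith) (fun j => (a j).at ω) (b.at ω) (c.at ω) hω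
    rw [← Randomisation.update_at, ← Randomisation.update_at] at this
    exact this
  exact this.uniformContinuous fun _ => randMod_pos hδ

/-- The interpretation of `φ` in the associated structure extends `a ↦ ⟨φ(a)⟩`. -/
structure IsExtension {n : ℕ} (φ : Formula L n) : Prop where
  uniformContinuous : UniformContinuous ((productRandomisation ℳ E hE).assoc.value φ)
  value_toMain : ∀ a : Fin n → (productRandomisation ℳ E hE).PreMain,
    (productRandomisation ℳ E hE).assoc.value φ
      (fun i => (productRandomisation ℳ E hE).toMain (a i)) = bracketClass ℳ E hE φ a

variable {ℳ E hE}

/-! ### Atomic formulas and connectives -/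

theorem isExtension_pred {n : ℕ} (P : L.Pred) (ts : Fin (L.arityP P) → Term L (Fin n)) :
    IsExtension ℳ E hE (.pred P ts) where
  uniformContinuous :=
    (((productRandomisation ℳ E hE).assoc.pred_mod P).uniformContinuous
      fun i => randMod_pos (L.modP_pos P i)).comp
      (uniformContinuous_pi.2 fun j => RandStruc.uniformContinuous_eval _ (ts j))
  value_toMain a := by
    simp only [RandStruc.value, Randomisation.eval_toMain, Randomisation.pred_toMain]
    refine congrArg _ (Subtype.ext <| funext fun ω => ?_)
    simp only [Randomisation.prePred, Randomisation.eval_preFunc_at]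
    rfl

theorem isExtension_dist {n : ℕ} (s t : Term L (Fin n)) :
    IsExtension ℳ E hE (.dist s t) where
  uniformContinuous :=
    (productRandomisation ℳ E hE).assoc.uniformContinuous₂_rdist.comp_prodMk
      (RandStruc.uniformContinuous_eval _ s) (RandStruc.uniformContinuous_eval _ t)
  value_toMain a := by
    simp only [RandStruc.value, Randomisation.eval_toMain, Randomisation.rdist_toMain]
    refine congrArg _ (Subtype.ext <| funext fun ω => ?_)
    simp only [Randomisation.preRdist, Randomisation.eval_preFunc_at]
    rfl

theorem IsExtension.neg {n : ℕ} {φ : Formula L n} (h : IsExtension ℳ E hE φ) :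
    IsExtension ℳ E hE (.neg φ) where
  uniformContinuous :=
    (LipschitzWith.mk_one
      (productRandomisation ℳ E hE).assoc.aux.dist_neg_le).uniformContinuous.comp
      h.uniformContinuous
  value_toMain a := by
    rw [RandStruc.value, h.value_toMain, bracketClass, Randomisation.auxClass_neg]
    rfl

theorem IsExtension.half {n : ℕ} {φ : Formula L n} (h : IsExtension ℳ E hE φ) :
    IsExtension ℳ E hE (.half φ) where
  uniformContinuous :=
    (LipschitzWith.mk_one
      (productRandomisation ℳ E hE).assoc.aux.dist_half_le).uniformContinuous.comp
      h.uniformContinuous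
  value_toMain a := by
    rw [RandStruc.value, h.value_toMain, bracketClass, Randomisation.auxClass_half]
    rfl

theorem IsExtension.sub {n : ℕ} {φ ψ : Formula L n} (hφ : IsExtension ℳ E hE φ)
    (hψ : IsExtension ℳ E hE ψ) : IsExtension ℳ E hE (.sub φ ψ) where
  uniformContinuous :=
    (productRandomisation ℳ E hE).assoc.aux.uniformContinuous₂_sub.comp_prodMk
      hφ.uniformContinuous hψ.uniformContinuous
  value_toMain a := by
    rw [RandStruc.value, hφ.value_toMain, hψ.value_toMain, bracketClass, bracketClass,
      Randomisation.auxClass_sub]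
    rfl

/-! ### Quantifiers -/

/-- The free variables and the witness form a single tuple, which suits a density argument over all
`n + 1` coordinates at once. -/
theorem bracketClass_inf_le {n : ℕ} (φ : Formula L (n + 1))
    (a : Fin (n + 1) → (productRandomisation ℳ E hE).PreMain) :
    bracketClass ℳ E hE (.inf φ) (fun i => a i.castSucc) ≤ bracketClass ℳ E hE φ a := by
  refine Randomisation.auxClass_le _ fun ω => ?_
  refine (iInf_le _ ((a (Fin.last n)).at ω)).trans_eq ?_
  refine congrArg ((ℳ ω).value φ) ?_
  exact Fin.snoc_init_self (α := fun _ => (ℳ ω).carrier) fun i => (a i).at ω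

/-- Near-minimisers chosen independently at each `ω` form a section, and the product contains all
sections. This is where the full product is needed for quantifiers. -/
theorem exists_dist_bracketClass_inf_le {n : ℕ} (φ : Formula L (n + 1))
    (a : Fin n → (productRandomisation ℳ E hE).PreMain) {ε : ℝ} (hε : 0 < ε) :
    ∃ b : (productRandomisation ℳ E hE).PreMain,
      dist (bracketClass ℳ E hE (.inf φ) a) (bracketClass ℳ E hE φ (Fin.snoc a b)) ≤ ε := by
  choose b hb using fun ω =>
    exists_lt_iInf_add (fun c : (ℳ ω).carrier => (ℳ ω).value φ (Fin.snoc (fun i => (a i).at ω) c))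
      (show 0 < ε / 4 by linarith)
  refine ⟨⟨⟨b, Set.mem_univ _⟩⟩, Randomisation.dist_auxClass_le _ hε fun ω => ?_⟩
  simp only [bracket, Randomisation.snoc_at]
  change |((⨅ c, (ℳ ω).value φ (Fin.snoc (fun i => (a i).at ω) c) : unitInterval) : ℝ) -
    (ℳ ω).value φ (Fin.snoc (fun i => (a i).at ω) (b ω))| ≤ ε / 4
  have h1 : ((⨅ c, (ℳ ω).value φ (Fin.snoc (fun i => (a i).at ω) c) : unitInterval) : ℝ) ≤
    (ℳ ω).value φ (Fin.snoc (fun i => (a i).at ω) (b ω)) :=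
    iInf_le (fun c => (ℳ ω).value φ (Fin.snoc (fun i => (a i).at ω) c)) (b ω)
  exact abs_le.2 ⟨by linarith [hb ω], by linarith⟩

/-- The statement covers all points of the completion, not only tuples of sections, because uniform
continuity of the infimum has to be passed on in the induction. -/
theorem IsExtension.isGLB {n : ℕ} {φ : Formula L (n + 1)} (h : IsExtension ℳ E hE φ)
    (a : Fin n → (productRandomisation ℳ E hE).assoc.main) :
    IsGLB (Set.range fun b => (productRandomisation ℳ E hE).assoc.value φ (Fin.snoc a b))
      (extendTuple (bracketClass ℳ E hE (.inf φ)) a) := by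
  have hb := uniformContinuous_bracketClass ℳ E hE (.inf φ)
  have hV := uniformContinuous_extendTuple hb
  have hF := h.uniformContinuous
  refine ⟨?_, fun w hw => ?_⟩
  · rintro _ ⟨b, rfl⟩
    -- The order is the equation `x ∸ y = 0` between continuous functions, a closed condition, so
    -- tuples of sections suffice.
    have key := ((productRandomisation ℳ E hE).denseRange_toMain (n + 1)).induction_on
      (p := fun c => (productRandomisation ℳ E hE).assoc.aux.sub
        (extendTuple (bracketClass ℳ E hE (.inf φ)) fun i => c i.castSucc)
        ((productRandomisation ℳ E hE).assoc.value φ c) =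
          (productRandomisation ℳ E hE).assoc.aux.zero) (Fin.snoc a b) ?_ ?_
    · simpa only [Fin.snoc_castSucc] using RVModel.le_def.2 key
    · exact isClosed_eq
        ((productRandomisation ℳ E hE).assoc.aux.uniformContinuous₂_sub.continuous.comp
          ((hV.continuous.comp (by fun_prop)).prodMk hF.continuous)) continuous_const
    · intro c
      rw [h.value_toMain]
      exact (congrArg (fun z => (productRandomisation ℳ E hE).assoc.aux.sub z _)
        (extendTuple_coe hb fun i => c i.castSucc)).trans (bracketClass_inf_le φ c)
  -- It remains to show that `w ∸ V(a)` has integral at most every `ε > 0`.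
  · rw [RVModel.le_def, ← dist_le_zero]
    refine le_of_forall_pos_le_add fun ε hε => ?_
    rw [zero_add]
    have hε3 : 0 < ε / 3 := by linarith
    obtain ⟨η, hη, hη'⟩ := Metric.uniformContinuous_iff.1 hV _ hε3
    obtain ⟨θ, hθ, hθ'⟩ := Metric.uniformContinuous_iff.1 hF _ hε3
    obtain ⟨c, hc⟩ := ((productRandomisation ℳ E hE).denseRange_toMain n).exists_dist_lt a
      (lt_min hη hθ)
    obtain ⟨b, hbc⟩ := exists_dist_bracketClass_inf_le (E := E) (hE := hE) φ c hε3
    have h1 := hη' (hc.trans_le (min_le_left _ _))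
    have h2 := hθ' (dist_snoc_lt (hc.trans_le (min_le_right _ _))
      ((productRandomisation ℳ E hE).toMain b))
    rw [← Randomisation.snoc_toMain, h.value_toMain] at h2
    have h3 : extendTuple (bracketClass ℳ E hE (.inf φ))
        (fun i => (productRandomisation ℳ E hE).toMain (c i)) =
      bracketClass ℳ E hE (.inf φ) c := extendTuple_coe hb c
    rw [h3] at h1
    -- As `w` lies below the value of `φ` at `(a, b)`, the distance from that value to `V(a)` is
    -- enough. It is crossed in three steps of at most `ε / 3`: replace `a` by `c` in `φ`, pass from
    -- `⟨φ(c,b)⟩` to `⟨inf φ(c)⟩`, and return from `c` to `a` in `V`.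
    refine (RVModel.e_sub_le_dist (hw ⟨(productRandomisation ℳ E hE).toMain b, rfl⟩)).trans ?_
    refine (dist_triangle4 _ _ _ _).trans (add_le_add (add_le_add h2.le
      ((dist_comm _ _).trans_le hbc)) ((dist_comm _ _).trans_le h1.le)) |>.trans_eq ?_
    ring

theorem IsExtension.value_inf {n : ℕ} {φ : Formula L (n + 1)} (h : IsExtension ℳ E hE φ) :
    (productRandomisation ℳ E hE).assoc.value (.inf φ) =
      extendTuple (bracketClass ℳ E hE (.inf φ)) :=
  funext fun a => (h.isGLB a).iInf_eq

theorem IsExtension.inf {n : ℕ} {φ : Formula L (n + 1)} (h : IsExtension ℳ E hE φ) :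
    IsExtension ℳ E hE (.inf φ) where
  uniformContinuous := by
    rw [h.value_inf]
    exact uniformContinuous_extendTuple (uniformContinuous_bracketClass ℳ E hE _)
  value_toMain a := by
    rw [h.value_inf]
    exact extendTuple_coe (uniformContinuous_bracketClass ℳ E hE _) a

/-- Both the interpretation and the pointwise bracket of `sup φ` equal those of `¬ inf ¬φ`, for
which the claim follows from the cases of `neg` and `inf`. -/
theorem IsExtension.sup {n : ℕ} {φ : Formula L (n + 1)} (h : IsExtension ℳ E hE φ) :
    IsExtension ℳ E hE (.sup φ) := by
  have h1 : (productRandomisation ℳ E hE).assoc.value (.sup φ) =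
      (productRandomisation ℳ E hE).assoc.value (.neg (.inf (.neg φ))) := funext fun a =>
    (RVModel.neg_iInf_neg fun b =>
      (productRandomisation ℳ E hE).assoc.value φ (Fin.snoc a b)).symm
  have h2 : bracketClass ℳ E hE (.sup φ) = bracketClass ℳ E hE (.neg (.inf (.neg φ))) :=
    funext fun a => congrArg _ <| Subtype.ext <| funext fun ω =>
      (uneg_iInf_uneg fun b => (ℳ ω).value φ (Fin.snoc (fun i => (a i).at ω) b)).symm
  have h3 := h.neg.inf.neg
  exact ⟨h1 ▸ h3.uniformContinuous, by rw [h1, h2]; exact h3.value_toMain⟩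

/-! ### The induction on formulas, and fullness -/

theorem isExtension {n : ℕ} (φ : Formula L n) : IsExtension ℳ E hE φ := by
  induction φ with
  | pred P ts => exact isExtension_pred P ts
  | dist s t => exact isExtension_dist s t
  | neg φ h => exact h.neg
  | half φ h => exact h.half
  | sub φ ψ hφ hψ => exact hφ.sub hψ
  | inf φ h => exact h.inf
  | sup φ h => exact h.sup

theorem productRandomisation_isFull : (productRandomisation ℳ E hE).IsFull := by
  classical
  intro a _ b _ X _
  -- Where `X` is strictly between `0` and `1` nothing is required, and the value of `b` serves as a
  -- default.
  refine ⟨fun ω => if X ω = 1 then a ω else b ω, Set.mem_univ _, fun ω => ⟨fun h => if_pos h,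
    fun h => if_neg ?_⟩⟩
  rw [h]
  exact zero_ne_one

end Product

end ContLogic

theorem mainTheorem10 {L : ContLogic.Signature.{u, v}} {Ω : Type w}
    (ℳ : Ω → ContLogic.Struc.{u, v, x} L)
    (E : ↥(Set.univ : Set (Ω → unitInterval)) → unitInterval)
    (hE : ContLogic.IsIntegrationSpace Set.univ E) :
    (ContLogic.productRandomisation ℳ E hE).IsFull ∧
    ∀ (n : ℕ) (φ : ContLogic.Formula L n) (a : Fin n → (ω : Ω) → (ℳ ω).carrier),
      (ContLogic.productRandomisation ℳ E hE).auxClass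
          ⟨ContLogic.bracket ℳ φ a, Set.mem_univ _⟩ =
        (ContLogic.productRandomisation ℳ E hE).assoc.value φ
          fun i => (ContLogic.productRandomisation ℳ E hE).mainClass ⟨a i, Set.mem_univ _⟩ :=
  ⟨ContLogic.productRandomisation_isFull, fun _ φ a =>
    ((ContLogic.isExtension φ).value_toMain fun i => ⟨⟨a i, Set.mem_univ _⟩⟩).symm⟩
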